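/- Let $m\ge 1$ be an integer. Put $A_0=1$, $A_k=\prod_{j=1}^{k}\frac{2j-1}{2j}$ for $k\ge 1$, and let $$h(x)=\sum_{k=0}^{m-1}2\,\frac{A_{m-1-k}}{A_m}\,x^k=\frac{4m}{2m-1}\;{}_2F_1\!\left(1,1-m;\tfrac32-m;x\right).$$ For integers $q\ge 1$ and $\ell\ge 1$ let $$\widehat I(q)=\frac{2}{\pi}\int_0^1\frac{\sin\bigl(q\arccos(2x-1)\bigr)}{h(x)(1-x)}\,dx,\qquad I(q)=\frac{2}{\pi}\int_0^1\frac{\sin\bigl((q-\frac12)\arccos(2x-1)\bigr)}{h(x)\,x^{1/2}(1-x)}\,dx,$$ $$c_\ell=\frac{2^{2-2m}}{A_m}\binom{2m-2}{m-1-\ell},$$ where the binomial coefficient is $0$ if $m-1-\ell<0$. Define the $(m-1)\times(m-1)$ matrices $R$, $Q$ and the row vector $v$ of length $m-1$ by $$R(i,j)=\widehat I(i+j-1),\qquad Q(i,j)=c_{i+j-1},\qquad v(j)=\sqrt{\frac{m}{2m-1}}\,I(j)-\frac{1}{2\sqrt m},\qquad 1\le i,j\le m-1,$$ and the $m\times m$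 matrices $$X=\begin{pmatrix}R&v^{t}\\ v&1-\frac{1}{\sqrt{2m-1}}\end{pmatrix},\qquad Y=\begin{pmatrix}Q&0\\0&\frac12\end{pmatrix},\qquad T_m=I-XY,$$ where in the last formula $I$ denotes the $m\times m$ identity matrix (for $m=1$ the blocks $R$, $Q$, $v$ are empty). Then for every $m\ge 1$ the matrix $T_m$ is invertible. -/

import Mathlib

noncomputable section

namespace LaguerreType

/-- `A_m = ∏_{j=1}^m (2j-1)/(2j)`, with `A_0 = 1`. -/
def A (m : ℕ) : ℝ :=
  ∏ j ∈ Finset.Icc 1 m, (2 * (j : ℝ) - 1) / (2 * (j : ℝ))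

/-- The polynomial `h(x) = ∑_{k=0}^{m-1} 2 (A_{m-1-k} / A_m) x^k`. It is the terminating
hypergeometric function of `h_eq_hypergeometric` below. In the sum `k ≤ m - 1`, so the subtraction
of natural numbers does not truncate. -/
def h (m : ℕ) (x : ℝ) : ℝ :=
  ∑ k ∈ Finset.range m, 2 * (A (m - 1 - k) / A m) * x ^ k

/-- `Î(q) = (2/π) ∫_0^1 sin(q arccos(2x-1)) / (h(x) (1-x)) dx`. -/
def Ihat (m q : ℕ) : ℝ :=
  2 / Real.pi * ∫ x in (0 : ℝ)..1,
    Real.sin ((q : ℝ) * Real.arccos (2 * x - 1)) / (h m x * (1 - x))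

/-- `I(q) = (2/π) ∫_0^1 sin((q-1/2) arccos(2x-1)) / (h(x) x^{1/2} (1-x)) dx`. -/
def I (m q : ℕ) : ℝ :=
  2 / Real.pi * ∫ x in (0 : ℝ)..1,
    Real.sin (((q : ℝ) - 1 / 2) * Real.arccos (2 * x - 1)) / (h m x * Real.sqrt x * (1 - x))

/-- `c_ℓ = (2^{2-2m} / A_m) * binom(2m-2, m-1-ℓ)`; the binomial coefficient is `0` when its lower
entry `m-1-ℓ` is negative. -/
def c (m l : ℕ) : ℝ :=
  (2 : ℝ) ^ (2 - 2 * (m : ℤ)) / A m *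
    (if l ≤ m - 1 then (Nat.choose (2 * m - 2) (m - 1 - l) : ℝ) else 0)

/-! The matrices below have rows and columns numbered from `0`: the 1-based indices
belonging to `i j : Fin (m - 1)` are `i + 1`, `j + 1`, so that the subscript `i + j - 1` of the
1-based formulas is `(i + 1) + (j + 1) - 1 = i + j + 1`. The `m × m` matrices have the index type `Fin (m - 1) ⊕ Unit`,
where the `Unit` summand is the last row or column. -/

/-- `R(i,j) = Î(i+j-1)` for `1 ≤ i, j ≤ m-1`. -/
def R (m : ℕ) : Matrix (Fin (m - 1)) (Fin (m - 1)) ℝ :=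
  Matrix.of fun i j => Ihat m ((i : ℕ) + (j : ℕ) + 1)

/-- The row vector `v(j) = √(m/(2m-1)) I(j) - 1/(2√m)` for `1 ≤ j ≤ m-1`. -/
def v (m : ℕ) : Matrix Unit (Fin (m - 1)) ℝ :=
  Matrix.of fun _ j =>
    Real.sqrt ((m : ℝ) / (2 * (m : ℝ) - 1)) * I m ((j : ℕ) + 1) - 1 / (2 * Real.sqrt (m : ℝ))

/-- `Q(i,j) = c_{i+j-1}` for `1 ≤ i, j ≤ m-1`. -/
def Q (m : ℕ) : Matrix (Fin (m - 1)) (Fin (m - 1)) ℝ :=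
  Matrix.of fun i j => c m ((i : ℕ) + (j : ℕ) + 1)

/-- `X = ((R, vᵗ), (v, 1 - 1/√(2m-1)))`. -/
def X (m : ℕ) : Matrix (Fin (m - 1) ⊕ Unit) (Fin (m - 1) ⊕ Unit) ℝ :=
  Matrix.fromBlocks (R m) (v m).transpose (v m)
    (Matrix.of fun _ _ => 1 - 1 / Real.sqrt (2 * (m : ℝ) - 1))

/-- `Y = ((Q, 0), (0, 1/2))`. -/
def Y (m : ℕ) : Matrix (Fin (m - 1) ⊕ Unit) (Fin (m - 1) ⊕ Unit) ℝ :=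
  Matrix.fromBlocks (Q m) 0 0 (Matrix.of fun _ _ => 1 / 2)

/-- `T_m = I - XY`. -/
def T (m : ℕ) : Matrix (Fin (m - 1) ⊕ Unit) (Fin (m - 1) ⊕ Unit) ℝ :=
  1 - X m * Y m

/-! Proved facts that justify the definitions: `h` is the stated hypergeometric function, it is
positive on `[0,1]`, and both integrals converge absolutely. -/

theorem A_succ (m : ℕ) : A (m + 1) = A m * ((2 * (m : ℝ) + 1) / (2 * (m : ℝ) + 2)) := by
  unfold A
  rw [Finset.prod_Icc_succ_top (by omega)]
  push_cast
  congr 1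
  ring

theorem A_pos (m : ℕ) : 0 < A m := by
  induction m with
  | zero => simp [A]
  | succ m ih => rw [A_succ]; positivity

theorem h_pos {m : ℕ} (hm : 1 ≤ m) {x : ℝ} (hx : 0 ≤ x) : 0 < h m x := by
  unfold h
  apply Finset.sum_pos'
  · intro k _
    have h1 := A_pos (m - 1 - k)
    have h2 := A_pos m
    positivity
  · refine ⟨0, Finset.mem_range.2 hm, ?_⟩
    have h1 := A_pos (m - 1 - 0)
    have h2 := A_pos m
    rw [pow_zero]
    positivity

theorem h_eq_hypergeometric {m : ℕ} (hm : 1 ≤ m) (x : ℝ) :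
    h m x = 4 * (m : ℝ) / (2 * (m : ℝ) - 1) *
      ordinaryHypergeometric (1 : ℝ) (1 - (m : ℝ)) (3 / 2 - (m : ℝ)) x := by
  obtain ⟨n, rfl⟩ : ∃ n, m = n + 1 := ⟨m - 1, by omega⟩
  rw [ordinaryHypergeometric_eq_tsum]
  have hz : ∀ k ∉ Finset.range (n + 1),
      (((k.factorial : ℝ)⁻¹ * (ascPochhammer ℝ k).eval 1 *
        (ascPochhammer ℝ k).eval (1 - ((n + 1 : ℕ) : ℝ)) *
        ((ascPochhammer ℝ k).eval (3 / 2 - ((n + 1 : ℕ) : ℝ)))⁻¹) • x ^ k) = 0 := by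
    intro k hk
    have hk' : n < k := by simpa using hk
    have : (ascPochhammer ℝ k).eval (1 - ((n + 1 : ℕ) : ℝ)) = 0 :=
      (ascPochhammer_eval_eq_zero_iff k _).2 ⟨n, hk', by push_cast; ring⟩
    rw [this, mul_zero, zero_mul, zero_smul]
  simp only
  rw [tsum_eq_sum hz, Finset.mul_sum]
  unfold h
  refine Finset.sum_congr rfl fun k hk => ?_
  have hkn : k ≤ n := by simpa [Nat.lt_succ_iff] using hk
  rw [smul_eq_mul, ← mul_assoc]
  congr 1
  have hfac : ((k.factorial : ℝ)⁻¹ * (ascPochhammer ℝ k).eval 1) = 1 := by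
    rw [ascPochhammer_eval_one]
    exact inv_mul_cancel₀ (by positivity)
  rw [hfac, one_mul]
  clear hk hfac
  induction k with
  | zero =>
    have := A_pos n
    rw [A_succ]
    simp only [ascPochhammer_zero, Polynomial.eval_one]
    simp only [add_tsub_cancel_right, tsub_zero]
    push_cast
    have h3 : (2 * ((n : ℝ) + 1) - 1) ≠ 0 := by
      have : (0 : ℝ) ≤ n := n.cast_nonneg
      linarith
    field_simp
    ring
  | succ k ih =>
    have ih := ih (by omega)
    obtain ⟨d, rfl⟩ : ∃ d, n = k + 1 + d := ⟨n - (k + 1), by omega⟩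
    have e1 : k + 1 + d + 1 - 1 - k = d + 1 := by omega
    have e2 : k + 1 + d + 1 - 1 - (k + 1) = d := by omega
    rw [e1, A_succ] at ih
    rw [e2, ascPochhammer_succ_eval, ascPochhammer_succ_eval]
    have hd : (0 : ℝ) ≤ d := d.cast_nonneg
    have key : ((1 : ℝ) - ((k + 1 + d + 1 : ℕ) : ℝ) + k) *
        ((3 / 2 : ℝ) - ((k + 1 + d + 1 : ℕ) : ℝ) + k)⁻¹ * ((2 * (d : ℝ) + 1) / (2 * (d : ℝ) + 2))
          = 1 := by
      push_cast
      have a1 : (3 / 2 : ℝ) - (k + 1 + d + 1) + k = - ((2 * d + 1) / 2) := by ring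
      have a2 : (1 : ℝ) - (k + 1 + d + 1) + k = - ((2 * d + 2) / 2) := by ring
      rw [a1, a2]
      field_simp
    rw [mul_inv]
    linear_combination ((1 : ℝ) - ((k + 1 + d + 1 : ℕ) : ℝ) + k) *
        ((3 / 2 : ℝ) - ((k + 1 + d + 1 : ℕ) : ℝ) + k)⁻¹ * ih
        - 2 * (A d / A (k + 1 + d + 1)) * key

theorem continuous_h (m : ℕ) : Continuous (h m) := by
  unfold h
  fun_prop

theorem abs_sin_nat_mul_le (n : ℕ) (t : ℝ) : |Real.sin (n * t)| ≤ n * |Real.sin t| := by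
  induction n with
  | zero => simp
  | succ n ih =>
    have e : ((n + 1 : ℕ) : ℝ) * t = n * t + t := by push_cast; ring
    rw [e, Real.sin_add]
    calc _ ≤ |Real.sin (n * t) * Real.cos t| + |Real.cos (n * t) * Real.sin t| := abs_add_le _ _
      _ ≤ |Real.sin (n * t)| * 1 + 1 * |Real.sin t| := by
        rw [abs_mul, abs_mul]
        gcongr
        · exact Real.abs_cos_le_one _
        · exact Real.abs_cos_le_one _
      _ ≤ _ := by push_cast; linarith

/-- With `θ = arccos(2x-1)`, one has `sin(θ/2) = √(1-x)`. -/
theorem abs_sin_half_arccos {x : ℝ} (hx : x ∈ Set.Ioo (0 : ℝ) 1) :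
    |Real.sin (Real.arccos (2 * x - 1) / 2)| = Real.sqrt (1 - x) := by
  rw [Real.abs_sin_half, Real.cos_arccos (by linarith [hx.1]) (by linarith [hx.2])]
  congr 1
  ring

theorem integrable_bound (C : ℝ) :
    MeasureTheory.IntegrableOn (fun x : ℝ => C * (x ^ (-(1 / 2) : ℝ) + (1 - x) ^ (-(1 / 2) : ℝ)))
      (Set.Ioo 0 1) := by
  have h1 : IntervalIntegrable (fun x : ℝ => x ^ (-(1 / 2) : ℝ)) MeasureTheory.volume 0 1 :=
    intervalIntegral.intervalIntegrable_rpow' (by norm_num)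
  have h2 : IntervalIntegrable (fun x : ℝ => (1 - x) ^ (-(1 / 2) : ℝ)) MeasureTheory.volume 0 1 := by
    have := (h1.comp_sub_left 1).symm
    simpa using this
  have h3 := (h1.add h2).const_mul C
  rw [intervalIntegrable_iff_integrableOn_Ioo_of_le zero_le_one] at h3
  exact h3

theorem rpow_neg_half_eq {y : ℝ} (hy : 0 < y) : y ^ (-(1 / 2) : ℝ) = (Real.sqrt y)⁻¹ := by
  rw [Real.rpow_neg hy.le, Real.sqrt_eq_rpow]

theorem inv_sqrt_mul_le {x : ℝ} (hx : x ∈ Set.Ioo (0 : ℝ) 1) :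
    (Real.sqrt x * Real.sqrt (1 - x))⁻¹ ≤
      2 * (x ^ (-(1 / 2) : ℝ) + (1 - x) ^ (-(1 / 2) : ℝ)) := by
  have hx1 : 0 < 1 - x := by linarith [hx.2]
  rw [rpow_neg_half_eq hx.1, rpow_neg_half_eq hx1]
  have ha : 0 < Real.sqrt x := Real.sqrt_pos.2 hx.1
  have hb : 0 < Real.sqrt (1 - x) := Real.sqrt_pos.2 hx1
  have hs1 := Real.sq_sqrt hx.1.le
  have hs2 := Real.sq_sqrt hx1.le
  set a := Real.sqrt x
  set b := Real.sqrt (1 - x)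
  have : 2 * (a⁻¹ + b⁻¹) = (2 * (a + b)) * (a * b)⁻¹ := by field_simp; ring
  rw [this]
  have hab : 1 ≤ 2 * (a + b) := by nlinarith [mul_pos ha hb]
  exact le_mul_of_one_le_left (by positivity) hab

/-- Common convergence criterion for the two integrals. -/
theorem integrable_aux {m : ℕ} (hm : 1 ≤ m) (p : ℕ) (g : ℝ → ℝ) (hg : Measurable g)
    (hb : ∀ x ∈ Set.Ioo (0 : ℝ) 1, |g x| ≤
      |Real.sin ((p : ℝ) * (Real.arccos (2 * x - 1) / 2))| /
        (h m x * Real.sqrt x * (1 - x))) :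
    IntervalIntegrable g MeasureTheory.volume 0 1 := by
  rw [intervalIntegrable_iff_integrableOn_Ioo_of_le zero_le_one]
  have hpos0 : 0 < h m 0 := h_pos hm le_rfl
  refine (integrable_bound (p * (h m 0)⁻¹ * 2)).mono' hg.aestronglyMeasurable ?_
  filter_upwards [MeasureTheory.ae_restrict_mem measurableSet_Ioo] with x hx
  rw [Real.norm_eq_abs]
  refine (hb x hx).trans ?_
  have hx1 : 0 < 1 - x := by linarith [hx.2]
  have hmono : h m 0 ≤ h m x := by
    unfold h
    refine Finset.sum_le_sum fun k _ => ?_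
    have h1 := A_pos (m - 1 - k)
    have h2 := A_pos m
    have h3 : (0 : ℝ) ^ k ≤ x ^ k := pow_le_pow_left₀ le_rfl hx.1.le k
    gcongr
  have hsx : 0 < Real.sqrt x := Real.sqrt_pos.2 hx.1
  have hs1 : 0 < Real.sqrt (1 - x) := Real.sqrt_pos.2 hx1
  have hsin := abs_sin_nat_mul_le p (Real.arccos (2 * x - 1) / 2)
  rw [abs_sin_half_arccos hx] at hsin
  calc _ ≤ (p * Real.sqrt (1 - x)) / (h m 0 * Real.sqrt x * (1 - x)) := by gcongr
    _ = p * (h m 0)⁻¹ * (Real.sqrt x * Real.sqrt (1 - x))⁻¹ := by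
      have := Real.mul_self_sqrt hx1.le
      nth_rewrite 2 [← this]
      field_simp
    _ ≤ p * (h m 0)⁻¹ * (2 * (x ^ (-(1 / 2) : ℝ) + (1 - x) ^ (-(1 / 2) : ℝ))) := by
      gcongr
      exact inv_sqrt_mul_le hx
    _ = _ := by ring

/-- The integral in the definition of `Î(q)` converges absolutely. -/
theorem intervalIntegrable_Ihat {m : ℕ} (hm : 1 ≤ m) (q : ℕ) :
    IntervalIntegrable (fun x : ℝ =>
      Real.sin ((q : ℝ) * Real.arccos (2 * x - 1)) / (h m x * (1 - x)))
      MeasureTheory.volume 0 1 := by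
  refine integrable_aux hm (2 * q) _ ?_ ?_
  · have := (continuous_h m).measurable
    have := Real.continuous_arccos.measurable
    fun_prop
  · intro x hx
    have hh := h_pos hm hx.1.le
    have hx1 : 0 < 1 - x := by linarith [hx.2]
    have hsx : 0 < Real.sqrt x := Real.sqrt_pos.2 hx.1
    have hsx1 : Real.sqrt x ≤ 1 := Real.sqrt_le_one.2 hx.2.le
    have e : ((2 * q : ℕ) : ℝ) * (Real.arccos (2 * x - 1) / 2)
        = q * Real.arccos (2 * x - 1) := by push_cast; ring
    rw [e, abs_div, abs_of_pos (mul_pos hh hx1)]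
    gcongr
    exact mul_le_of_le_one_right hh.le hsx1

/-- The integral in the definition of `I(q)` converges absolutely. -/
theorem intervalIntegrable_I {m : ℕ} (hm : 1 ≤ m) {q : ℕ} (hq : 1 ≤ q) :
    IntervalIntegrable (fun x : ℝ =>
      Real.sin (((q : ℝ) - 1 / 2) * Real.arccos (2 * x - 1)) /
        (h m x * Real.sqrt x * (1 - x)))
      MeasureTheory.volume 0 1 := by
  refine integrable_aux hm (2 * q - 1) _ ?_ ?_
  · have := (continuous_h m).measurable
    have := Real.continuous_arccos.measurable
    fun_prop
  · intro x hx
    have hh := h_pos hm hx.1.le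
    have hx1 : 0 < 1 - x := by linarith [hx.2]
    have hsx : 0 < Real.sqrt x := Real.sqrt_pos.2 hx.1
    have e : ((2 * q - 1 : ℕ) : ℝ) * (Real.arccos (2 * x - 1) / 2)
        = ((q : ℝ) - 1 / 2) * Real.arccos (2 * x - 1) := by
      rw [Nat.cast_sub (by omega)]
      push_cast
      ring
    rw [e, abs_div, abs_of_pos (mul_pos (mul_pos hh hsx) hx1)]

end LaguerreType

end

noncomputable section

/-! A kernel vector of `T m` is turned into a polynomial identity on the unit circle. With z =
exp(iθ) and x = cos²(θ/2) = (1+z)²/(4z), h becomes an even Laurent polynomial H of degree n = m-1,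
positive on the circle. Let Λ be integration against 1/H and S(q) = ∑_{|k|<q} Λ(z^k). The Dirichlet
kernel gives I(q) = 2S(q) and Î(q) = S(q) + S(q+1). With σ₁ = √H(1) and σ₀ = √H(-1), this gives v(j)
= σ₀S(j) - 1/σ₁ and 1/√(2m-1) = σ₀/σ₁. Moreover 2(c_k + c_{k+1}) = H_k - H_{k+1}
(`two_mul_c_add_c`).

If w = XYw, put (g, b) = Yw, let f be the upper part of X(g, b), extended to all indices, and p(z) =
2bσ₀ + ∑ 2g_j(z^{j+1} + z^j). The increments of f are the moments Λ(z^k p), k > 0. Let κ be the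
generating series of f(0) and these increments. By summation by parts, g = Qf says that Hκ = p(1/z)
- N(z) with a polynomial N (`exists_polynomial`). Comparing moments, Λ(z^{-k}N) = 0 for k > 0.

Polynomials with this orthogonality are rigid: |N|² is a constant multiple of H, and N ≠ 0 has no
zero in [-1,1], so N(1)/σ₁ = N(-1)/σ₀ (`mul_invert_eq`, `eval_ne_zero`, `sqrt_mul_eval`). The last
row of the kernel equation says N(1)/σ₁ = -N(-1)/σ₀, hence N = 0. Then p is orthogonal in the same
sense, and its values 2bσ₀ at -1 and -2bσ₁ at 1 force b = 0 and p = 0, so g = 0 and w = 0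
(`eq_zero_of_mem_kernel`). -/

open LaurentPolynomial Filter Topology

/-! ### Positive functionals inverse to H, and polynomials orthogonal to the multiples of X -/

/-- `Λ` is a positive functional on real Laurent polynomials which is inverse to the even
Laurent polynomial `H`: it is integration on the unit circle against `1 / H`. -/
structure IsReciprocalMoment (H : ℝ[T;T⁻¹]) (Λ : ℝ[T;T⁻¹] →ₗ[ℝ] ℝ) : Prop where
  invert_eq : invert H = H
  map_invert : ∀ P, Λ (invert P) = Λ P
  map_left_mul : ∀ P, Λ (H * P) = P.coeff 0
  nonneg : ∀ P, 0 ≤ Λ (P * invert P)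

/-- This is |1 - cz|²|q|² on the circle for c = ±1, with t = z, u = z⁻¹ and r the conjugate of q. -/
theorem one_sub_mul_one_sub_of_mul_eq_one {A : Type*} [CommRing A] {c t u d : A} (hd : d = 1 + 1)
    (hc : c * c = 1)
    (ht : t * u = 1) (q r : A) :
    (1 - c * t) * q * ((1 - c * u) * r) = d * (q * r) - c * (q * r * t) - c * (q * r * u) := by
  linear_combination (q * r) * (hc + c * c * ht - hd)

namespace IsReciprocalMoment

theorem coeff_mul_T (P : ℝ[T;T⁻¹]) (n m : ℤ) : (P * T n).coeff m = P.coeff (m - n) := by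
  induction P using LaurentPolynomial.induction_on' with
  | add p q hp hq => simp [add_mul, hp, hq]
  | C_mul_T k a =>
    rw [mul_T_assoc, ← single_eq_C_mul_T, ← single_eq_C_mul_T]
    simp only [AddMonoidAlgebra.coeff_single, Finsupp.single_apply]
    congr 1
    apply propext
    constructor <;> intro h <;> omega

theorem invert_invert (P : ℝ[T;T⁻¹]) : invert (invert P) = P := involutive_invert P

variable {H : ℝ[T;T⁻¹]} {Λ : ℝ[T;T⁻¹] →ₗ[ℝ] ℝ} (hΛ : IsReciprocalMoment H Λ)
include hΛ

theorem map_mul_T (P : ℝ[T;T⁻¹]) (n : ℤ) : Λ (H * P * T (-n)) = P.coeff n := by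
  rw [mul_assoc, hΛ.map_left_mul, coeff_mul_T]; simp

/-- The coefficient of D at n is Λ(H·D·z^{-n}), and H·z^{-n} is a combination of powers of z. -/
theorem eq_zero_of_map_T_mul {D : ℝ[T;T⁻¹]} (h : ∀ k : ℤ, Λ (T k * D) = 0) : D = 0 := by
  have h' : ∀ E : ℝ[T;T⁻¹], Λ (E * D) = 0 := by
    intro E
    induction E using LaurentPolynomial.induction_on' with
    | add p q hp hq => rw [add_mul, map_add, hp, hq, add_zero]
    | C_mul_T k a => rw [mul_assoc, ← smul_eq_C_mul, map_smul, h, smul_zero]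
  ext n
  rw [← hΛ.map_mul_T, mul_right_comm, h']
  simp

theorem map_mul_invert_comm (P Q : ℝ[T;T⁻¹]) : Λ (P * invert Q) = Λ (Q * invert P) := by
  rw [← hΛ.map_invert, map_mul, invert_invert, mul_comm]

/-- A null vector of a positive semidefinite form is orthogonal to everything (Cauchy–Schwarz), so
`eq_zero_of_map_T_mul` applies. -/
theorem eq_zero_of_map_mul_invert {P : ℝ[T;T⁻¹]} (h : Λ (P * invert P) = 0) : P = 0 := by
  have key : ∀ Q, Λ (P * invert Q) = 0 := by
    intro Q
    have h1 : ∀ t : ℝ, 0 ≤ 2 * t * Λ (P * invert Q) + t ^ 2 * Λ (Q * invert Q) := by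
      intro t
      have := hΛ.nonneg (P + t • Q)
      have e : (P + t • Q) * invert (P + t • Q) = P * invert P + t • (P * invert Q)
          + t • (Q * invert P) + (t ^ 2) • (Q * invert Q) := by
        simp only [map_add, add_mul, mul_add, smul_eq_C_mul, map_mul, invert_C, map_pow]
        ring
      rw [e, map_add, map_add, map_add, map_smul, map_smul, map_smul, h,
        hΛ.map_mul_invert_comm Q P] at this
      simp only [smul_eq_mul] at this
      linarith
    have hq := hΛ.nonneg Q
    set x := Λ (P * invert Q)
    set y := Λ (Q * invert Q)
    -- The minimum of 2tx + t²y is at t = -x/y; the denominator y + 1 also covers y = 0.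
    have h2 := h1 (-x / (y + 1))
    have hy : 0 < y + 1 := by linarith
    have e : 2 * (-x / (y + 1)) * x + (-x / (y + 1)) ^ 2 * y = -(x ^ 2 * (y + 2)) / (y + 1) ^ 2 := by
      field_simp; ring
    rw [e, le_div_iff₀ (by positivity), zero_mul] at h2
    have : x ^ 2 * (y + 2) ≥ x ^ 2 * 1 := by gcongr; linarith
    have : x ^ 2 ≤ 0 := by linarith
    exact pow_eq_zero_iff (two_ne_zero) |>.1 (le_antisymm this (sq_nonneg x))
  refine hΛ.eq_zero_of_map_T_mul fun k => ?_
  have := key (T (-k))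
  rwa [invert_T, neg_neg, mul_comm] at this

omit hΛ in
theorem map_T_mul_invert_mul_eq_zero {p : Polynomial ℝ}
    (hp : ∀ k : ℕ, Λ (T (-(k + 1)) * p.toLaurent) = 0) (q : Polynomial ℝ) :
    Λ (T (-1) * invert q.toLaurent * p.toLaurent) = 0 := by
  induction q using Polynomial.induction_on' with
  | add a b ha hb => simp only [map_add, mul_add, add_mul, ha, hb, add_zero]
  | monomial k a =>
    rw [← Polynomial.C_mul_X_pow_eq_monomial, Polynomial.toLaurent_C_mul_X_pow, map_mul invert,
      invert_C, invert_T]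
    have e : T (-1) * (C a * T (-(k : ℤ))) * p.toLaurent
        = a • (T (-(k + 1)) * p.toLaurent) := by
      rw [smul_eq_C_mul, neg_add, T_add]; ring
    rw [e, map_smul, hp, smul_zero]

/-- If `p` is orthogonal to `X q` for all polynomials `q`, then `|p|²` is a multiple of `H`. -/
theorem mul_invert_eq {p : Polynomial ℝ}
    (hp : ∀ k : ℕ, Λ (T (-(k + 1)) * p.toLaurent) = 0) :
    p.toLaurent * invert p.toLaurent = C (Λ (p.toLaurent * invert p.toLaurent)) * H := by
  set c := Λ (p.toLaurent * invert p.toLaurent) with hc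
  -- All moments of |p|² - cH vanish: the negative ones by orthogonality, the one at 0 by the choice
  -- of c, the positive ones by symmetry.
  have hneg : ∀ k : ℕ, Λ (T (-(k + 1)) * (p.toLaurent * invert p.toLaurent - C c * H)) = 0 := by
    intro k
    have e : T (-(k + 1)) * (p.toLaurent * invert p.toLaurent - C c * H)
        = T (-1) * invert ((Polynomial.X ^ k * p).toLaurent) * p.toLaurent
          - c • (H * T (-(k + 1))) := by
      rw [smul_eq_C_mul, map_mul, Polynomial.toLaurent_X_pow, map_mul, invert_T,
        neg_add, T_add]; ring
    rw [e, map_sub, map_T_mul_invert_mul_eq_zero hp, map_smul, hΛ.map_left_mul]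
    have : (-(1:ℤ) + -(k:ℤ)) ≠ 0 := by omega
    simp [this]
  have hinv : invert (p.toLaurent * invert p.toLaurent - C c * H)
      = p.toLaurent * invert p.toLaurent - C c * H := by
    rw [map_sub, map_mul, map_mul, invert_invert, invert_C, hΛ.invert_eq]; ring
  refine sub_eq_zero.1 (hΛ.eq_zero_of_map_T_mul fun k => ?_)
  rcases lt_trichotomy k 0 with hk | rfl | hk
  · obtain ⟨j, rfl⟩ : ∃ j : ℕ, k = -(j + 1) := ⟨(-k - 1).toNat, by omega⟩
    exact hneg j
  · rw [T_zero, one_mul, map_sub, ← hc, ← smul_eq_C_mul, map_smul, ← mul_one H, hΛ.map_left_mul]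
    have : (1 : ℝ[T;T⁻¹]).coeff 0 = 1 := by rw [← T_zero]; simp
    rw [this]; simp
  · obtain ⟨j, rfl⟩ : ∃ j : ℕ, k = j + 1 := ⟨(k - 1).toNat, by omega⟩
    rw [← hΛ.map_invert, map_mul, hinv, invert_T]
    exact hneg j

/-- The expression is Λ(|(1 - sz)q|²), strictly positive because (1 - sX)q is a nonzero polynomial.
-/
theorem map_sub_mul_pos {q : Polynomial ℝ} (hq0 : q ≠ 0) {s : ℝ} (hs : s ^ 2 = 1) :
    0 < 2 * Λ (q.toLaurent * invert q.toLaurent)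
      - s * Λ (q.toLaurent * invert q.toLaurent * T 1)
      - s * Λ (q.toLaurent * invert q.toLaurent * T (-1)) := by
  have hT : (T 1 * T (-1) : ℝ[T;T⁻¹]) = 1 := by rw [← T_add]; simp
  have e0 : ((1 - Polynomial.C s * Polynomial.X) * q).toLaurent = (1 - C s * T 1) * q.toLaurent := by
    rw [map_mul, map_sub, map_mul, Polynomial.toLaurent_X, Polynomial.toLaurent_C, map_one]
  have hpos := hΛ.nonneg ((1 - C s * T 1) * q.toLaurent)
  have hne : Λ ((1 - C s * T 1) * q.toLaurent * invert ((1 - C s * T 1) * q.toLaurent)) ≠ 0 := by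
    intro h
    have h := hΛ.eq_zero_of_map_mul_invert h
    rw [← e0, Polynomial.toLaurent_eq_zero] at h
    rcases mul_eq_zero.1 h with h | h
    · have := congrArg (Polynomial.eval 0) h
      simp at this
    · exact hq0 h
  have e : (1 - C s * T 1) * q.toLaurent * invert ((1 - C s * T 1) * q.toLaurent)
      = (2:ℝ) • (q.toLaurent * invert q.toLaurent)
        - s • (q.toLaurent * invert q.toLaurent * T 1)
        - s • (q.toLaurent * invert q.toLaurent * T (-1)) := by
    have hs' : (C s * C s : ℝ[T;T⁻¹]) = 1 := by rw [← map_mul, ← sq, hs, map_one]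
    have h2' : (C 2 : ℝ[T;T⁻¹]) = 1 + 1 := by rw [← map_one C, ← map_add]; norm_num
    have hi : invert ((1 - C s * T 1) * q.toLaurent) = (1 - C s * T (-1)) * invert q.toLaurent := by
      rw [map_mul, map_sub, map_one, map_mul, invert_C, invert_T]
    rw [hi, smul_eq_C_mul, smul_eq_C_mul, smul_eq_C_mul]
    exact one_sub_mul_one_sub_of_mul_eq_one h2' hs' hT _ _
  have hlt := lt_of_le_of_ne hpos hne.symm
  rwa [e, map_sub, map_sub, map_smul, map_smul, map_smul] at hlt

/-- If p = (X - t)q, orthogonality to Xq gives Λ(|q|²) = tΛ(|q|²z⁻¹). Since |Λ(|q|²z⁻¹)| < Λ(|q|²)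
by `map_sub_mul_pos`, this forces |t| > 1. -/
theorem eval_ne_zero {p : Polynomial ℝ} (hp : ∀ k : ℕ, Λ (T (-(k + 1)) * p.toLaurent) = 0)
    (hp0 : p ≠ 0) {t : ℝ} (ht : t ∈ Set.Icc (-1 : ℝ) 1) : p.eval t ≠ 0 := by
  intro h0
  obtain ⟨q, rfl⟩ := Polynomial.dvd_iff_isRoot.2 h0
  have hq0 : q ≠ 0 := right_ne_zero_of_mul hp0
  have hpos := hΛ.nonneg q.toLaurent
  have hne : Λ (q.toLaurent * invert q.toLaurent) ≠ 0 := fun h =>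
    hq0 (Polynomial.toLaurent_eq_zero.1 (hΛ.eq_zero_of_map_mul_invert h))
  have hT : (T 1 * T (-1) : ℝ[T;T⁻¹]) = 1 := by rw [← T_add]; simp
  have h2 := map_T_mul_invert_mul_eq_zero hp q
  have e1 : T (-1) * invert q.toLaurent * ((Polynomial.X - Polynomial.C t) * q).toLaurent
      = q.toLaurent * invert q.toLaurent - t • (q.toLaurent * invert q.toLaurent * T (-1)) := by
    rw [map_mul, map_sub, Polynomial.toLaurent_X, Polynomial.toLaurent_C, smul_eq_C_mul]
    linear_combination (q.toLaurent * invert q.toLaurent) * hT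
  rw [e1, map_sub, map_smul, smul_eq_mul] at h2
  have h3 : Λ (q.toLaurent * invert q.toLaurent * T 1)
      = Λ (q.toLaurent * invert q.toLaurent * T (-1)) := by
    rw [← hΛ.map_invert]
    simp only [map_mul, invert_invert, invert_T]
    rw [mul_comm (invert _)]
  have key : ∀ s : ℝ, s ^ 2 = 1 → 0 < Λ (q.toLaurent * invert q.toLaurent)
      - s * Λ (q.toLaurent * invert q.toLaurent * T (-1)) := by
    intro s hs
    have := hΛ.map_sub_mul_pos hq0 hs
    rw [h3] at this
    linarith
  have k1 := key 1 (by norm_num)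
  have k2 := key (-1) (by norm_num)
  obtain ⟨t1, t2⟩ := ht
  rcases le_total 0 (Λ (q.toLaurent * invert q.toLaurent * T (-1))) with h | h <;> nlinarith

end IsReciprocalMoment

/-! ### Values at 1 and -1 -/

/-- Evaluation of a real Laurent polynomial at a unit. -/
def laurentEval (u : ℝˣ) : ℝ[T;T⁻¹] →+* ℝ := eval₂ (RingHom.id ℝ) u

theorem laurentEval_T (u : ℝˣ) (n : ℤ) : laurentEval u (T n) = (u ^ n : ℝˣ) :=
  eval₂_T _ _ _

theorem laurentEval_C (u : ℝˣ) (a : ℝ) : laurentEval u (C a) = a := eval₂_C _ _ _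

theorem laurentEval_toLaurent (u : ℝˣ) (p : Polynomial ℝ) :
    laurentEval u p.toLaurent = p.eval (u : ℝ) := by
  rw [laurentEval, eval₂_toLaurent]; rfl

theorem laurentEval_invert {u : ℝˣ} (hu : u⁻¹ = u) (P : ℝ[T;T⁻¹]) :
    laurentEval u (invert P) = laurentEval u P := by
  induction P using LaurentPolynomial.induction_on' with
  | add p q hp hq => rw [map_add, map_add, map_add, hp, hq]
  | C_mul_T k a =>
    rw [map_mul, map_mul, map_mul, invert_C, invert_T, laurentEval_T, laurentEval_T,
      zpow_neg, ← inv_zpow, hu]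

/-- A polynomial orthogonal to all multiples of `X` has values at `1` and `-1` in the ratio of the
square roots of the values of `H`. -/
theorem IsReciprocalMoment.sqrt_mul_eval {H : ℝ[T;T⁻¹]} {Λ : ℝ[T;T⁻¹] →ₗ[ℝ] ℝ}
    (hΛ : IsReciprocalMoment H Λ) {p : Polynomial ℝ}
    (hp : ∀ k : ℕ, Λ (T (-(k + 1)) * p.toLaurent) = 0)
    (h1 : 0 < laurentEval 1 H) (h0 : 0 < laurentEval (-1) H) :
    √(laurentEval (-1) H) * p.eval 1 = √(laurentEval 1 H) * p.eval (-1) := by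
  by_cases hp0 : p = 0
  · simp [hp0]
  have hm := hΛ.mul_invert_eq hp
  have e1 := congrArg (laurentEval 1) hm
  have e0 := congrArg (laurentEval (-1)) hm
  rw [map_mul, map_mul, laurentEval_invert (by simp), laurentEval_toLaurent, laurentEval_C] at e1 e0
  set c := Λ (p.toLaurent * invert p.toLaurent)
  simp only [Units.val_one, Units.val_neg] at e1 e0
  -- |p|² = cH fixes p(1) and p(-1) up to sign; the signs agree because p has no zero in [-1,1].
  have hsign : 0 ≤ p.eval 1 * p.eval (-1) := by
    by_contra hneg
    push Not at hneg
    have hcont : ContinuousOn (fun t => p.eval t) (Set.Icc (-1 : ℝ) 1) := p.continuous.continuousOn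
    rcases mul_neg_iff.1 hneg with ⟨ha, hb⟩ | ⟨ha, hb⟩
    · obtain ⟨t, ht, h⟩ := intermediate_value_Icc (by norm_num) hcont ⟨hb.le, ha.le⟩
      exact hΛ.eval_ne_zero hp hp0 ht h
    · obtain ⟨t, ht, h⟩ := intermediate_value_Icc' (by norm_num) hcont ⟨ha.le, hb.le⟩
      exact hΛ.eval_ne_zero hp hp0 ht h
  have hs0 : 0 < √(laurentEval (-1) H) := Real.sqrt_pos.2 h0
  have hs1 : 0 < √(laurentEval 1 H) := Real.sqrt_pos.2 h1
  have hsq : (√(laurentEval (-1) H) * p.eval 1) ^ 2 = (√(laurentEval 1 H) * p.eval (-1)) ^ 2 := by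
    rw [mul_pow, mul_pow, Real.sq_sqrt h0.le, Real.sq_sqrt h1.le, sq, sq, e1, e0]; ring
  rcases sq_eq_sq_iff_eq_or_eq_neg.1 hsq with h | h
  · exact h
  · have hne := hΛ.eval_ne_zero hp hp0 (t := 1) (by norm_num)
    have : 0 ≤ (√(laurentEval (-1) H) * p.eval 1) * (√(laurentEval 1 H) * p.eval (-1)) := by
      have := mul_nonneg (mul_pos hs0 hs1).le hsign
      linarith
    have h' : √(laurentEval 1 H) * p.eval (-1) = -(√(laurentEval (-1) H) * p.eval 1) := by
      linarith
    rw [h'] at this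
    have : √(laurentEval (-1) H) * p.eval 1 = 0 := by nlinarith
    rcases mul_eq_zero.1 this with h | h
    · exact absurd h hs0.ne'
    · exact absurd h hne

/-! ### Sums over integer intervals, convolution with null sequences, coefficients -/

theorem sum_Ico_zero_int (u : ℤ → ℝ) (M : ℕ) :
    ∑ j ∈ Finset.Ico (0 : ℤ) M, u j = ∑ j ∈ Finset.range M, u j := by
  symm
  refine Finset.sum_of_injOn (fun j : ℕ => (j : ℤ)) (fun a _ b _ h => by simpa using h)
    (fun j hj => by simpa using hj) (fun j hj hj' => ?_) (fun _ _ => rfl)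
  exfalso
  simp only [Finset.mem_Ico] at hj
  exact hj' ⟨j.toNat, by simp; omega, by simp; omega⟩

theorem sum_Icc_neg_int (u : ℤ → ℝ) (n : ℕ) :
    ∑ i ∈ Finset.Icc (-(n : ℤ)) n, u i
      = ∑ i ∈ Finset.range (n + 1), u (-(i : ℤ)) + ∑ i ∈ Finset.range (n + 1), u i - u 0 := by
  induction n with
  | zero => simp
  | succ n ih =>
    rw [Finset.sum_range_succ, Finset.sum_range_succ _ (n + 1)]
    have e : Finset.Icc (-((n + 1 : ℕ) : ℤ)) ((n + 1 : ℕ) : ℤ)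
        = insert (-((n + 1 : ℕ) : ℤ)) (insert ((n + 1 : ℕ) : ℤ) (Finset.Icc (-(n : ℤ)) n)) := by
      ext i; simp only [Finset.mem_Icc, Finset.mem_insert]; omega
    rw [e, Finset.sum_insert (by simp; omega), Finset.sum_insert (by simp), ih]
    ring

/-- For large M the difference consists of |k| terms, each tending to 0. -/
theorem tendsto_sum_Ico_add_sub {a : ℤ → ℝ} (ha : Tendsto a atTop (𝓝 0)) (k : ℤ) :
    Tendsto (fun M : ℤ => ∑ j ∈ Finset.Ico 0 (M + k), a j - ∑ j ∈ Finset.Ico 0 M, a j)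
      atTop (𝓝 0) := by
  have hs : ∀ M : ℤ, 0 ≤ M →
      ∑ j ∈ Finset.Ico 0 (M + 1), a j = ∑ j ∈ Finset.Ico 0 M, a j + a M := by
    intro M hM
    have e : Finset.Ico 0 (M + 1) = insert M (Finset.Ico 0 M) := by
      ext i; simp only [Finset.mem_Ico, Finset.mem_insert]; omega
    rw [e, Finset.sum_insert (by simp), add_comm]
  induction k using Int.induction_on with
  | zero => simp
  | succ k ih =>
    have h2 : Tendsto (fun M : ℤ => a (M + k)) atTop (𝓝 0) :=
      ha.comp (tendsto_atTop_add_const_right _ _ tendsto_id)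
    have h3 := ih.add h2
    rw [add_zero] at h3
    refine h3.congr' ?_
    filter_upwards [eventually_ge_atTop 0] with M hM
    rw [← add_assoc, hs (M + k) (by omega)]
    ring
  | pred k ih =>
    have h2 : Tendsto (fun M : ℤ => a (M + (-k - 1))) atTop (𝓝 0) :=
      ha.comp (tendsto_atTop_add_const_right _ _ tendsto_id)
    have h3 := ih.sub h2
    rw [sub_zero] at h3
    refine h3.congr' ?_
    filter_upwards [eventually_ge_atTop (k + 1 : ℤ)] with M hM
    have := hs (M + (-k - 1)) (by omega)
    rw [show M + (-(k : ℤ) - 1) + 1 = M + -k by ring] at this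
    rw [this]
    ring

/-- Summation by parts for the convolution of a finite sequence with a null sequence. -/
theorem tendsto_sum_mul_conv {n : ℕ} {H κ w : ℤ → ℝ} (hκ0 : ∀ j < 0, κ j = 0)
    (hκ : Tendsto κ atTop (𝓝 0)) {B : ℝ} (hw : ∀ i, |w i| ≤ B) {ν : ℤ → ℝ}
    (hν : ∀ i, ν i = ∑ l ∈ Finset.Icc (-(n : ℤ)) n, H l * κ (i - l))
    (hν0 : ∀ i : ℤ, n < i → ν i = 0) :
    Tendsto (fun M : ℕ => ∑ j ∈ Finset.range M, κ j *
      ∑ l ∈ Finset.Icc (-(n : ℤ)) n, H l * w (j + l)) atTop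
      (𝓝 (∑ i ∈ Finset.Icc (-(n : ℤ)) n, ν i * w i)) := by
  have ha : ∀ l, Tendsto (fun j => κ j * w (j + l)) atTop (𝓝 0) := by
    intro l
    refine squeeze_zero_norm (a := fun j => |κ j| * B) (fun j => ?_) ?_
    · rw [Real.norm_eq_abs, abs_mul]; gcongr; exact hw _
    · simpa using hκ.abs.mul_const B
  have hshift : ∀ l ∈ Finset.Icc (-(n : ℤ)) n, ∀ M : ℤ,
      ∑ i ∈ Finset.Ico (-(n : ℤ)) M, κ (i - l) * w i
        = ∑ j ∈ Finset.Ico 0 (M + -l), κ j * w (j + l) := by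
    intro l hl M
    rw [Finset.mem_Icc] at hl
    symm
    refine Finset.sum_of_injOn (fun j => j + l) (fun a _ b _ h => by simpa using h)
      (fun j hj => ?_) (fun i hi hi' => ?_) (fun j _ => by simp)
    · simp only [Finset.coe_Ico, Set.mem_Ico] at hj ⊢; omega
    · rw [hκ0, zero_mul]
      simp only [Finset.mem_Ico] at hi
      by_contra h
      exact hi' ⟨i - l, by simp only [Finset.coe_Ico, Set.mem_Ico]; omega, by simp⟩
  -- With every inner range shifted by -l the sum equals the limit exactly; restoring the common
  -- range changes only a bounded number of null terms (`hlim`).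
  have hconst : ∀ M : ℤ, n < M →
      ∑ l ∈ Finset.Icc (-(n : ℤ)) n, H l * ∑ j ∈ Finset.Ico 0 (M + -l), κ j * w (j + l)
        = ∑ i ∈ Finset.Icc (-(n : ℤ)) n, ν i * w i := by
    intro M hM
    have e1 : ∑ i ∈ Finset.Icc (-(n : ℤ)) n, ν i * w i
        = ∑ i ∈ Finset.Ico (-(n : ℤ)) M, ν i * w i := by
      refine Finset.sum_subset (fun i hi => ?_) (fun i hi hi' => ?_)
      · simp only [Finset.mem_Icc, Finset.mem_Ico] at hi ⊢; omega
      · rw [hν0, zero_mul]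
        simp only [Finset.mem_Icc, Finset.mem_Ico] at hi hi'; omega
    rw [e1]
    simp only [hν, Finset.sum_mul]
    rw [Finset.sum_comm]
    refine Finset.sum_congr rfl fun l hl => ?_
    rw [← hshift l hl, Finset.mul_sum]
    refine Finset.sum_congr rfl fun i _ => by ring
  have hlim : Tendsto (fun M : ℤ => ∑ l ∈ Finset.Icc (-(n : ℤ)) n,
      H l * (∑ j ∈ Finset.Ico 0 (M + -l), κ j * w (j + l)
        - ∑ j ∈ Finset.Ico 0 M, κ j * w (j + l))) atTop (𝓝 0) := by
    have : Tendsto (fun M : ℤ => ∑ l ∈ Finset.Icc (-(n : ℤ)) n,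
      H l * (∑ j ∈ Finset.Ico 0 (M + -l), κ j * w (j + l)
        - ∑ j ∈ Finset.Ico 0 M, κ j * w (j + l))) atTop
        (𝓝 (∑ l ∈ Finset.Icc (-(n : ℤ)) n, H l * 0)) :=
      tendsto_finsetSum _ fun l _ => (tendsto_sum_Ico_add_sub (ha l) (-l)).const_mul _
    simpa using this
  have hlim2 := (hlim.const_sub (∑ i ∈ Finset.Icc (-(n : ℤ)) n, ν i * w i)).comp
    (tendsto_natCast_atTop_atTop (R := ℤ))
  rw [sub_zero] at hlim2
  refine hlim2.congr' ?_
  filter_upwards [eventually_gt_atTop n] with M hM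
  simp only [Function.comp]
  rw [← hconst M (by omega), ← Finset.sum_sub_distrib]
  simp only [mul_sub, sub_sub_cancel]
  simp only [sum_Ico_zero_int, Finset.mul_sum]
  rw [Finset.sum_comm]
  refine Finset.sum_congr rfl fun j _ => Finset.sum_congr rfl fun l _ => by ring

theorem laurent_eq_sum {n : ℕ} {H : ℝ[T;T⁻¹]} (hH : ∀ l : ℤ, (n : ℤ) < |l| → H.coeff l = 0) :
    H = ∑ l ∈ Finset.Icc (-(n : ℤ)) n, H.coeff l • T l := by
  ext i
  rw [AddMonoidAlgebra.coeff_sum, Finset.sum_apply']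
  simp only [AddMonoidAlgebra.coeff_smul, Finsupp.smul_apply, T_apply, smul_eq_mul, mul_ite, mul_one,
    mul_zero, Finset.sum_ite_eq']
  split_ifs with h
  · rfl
  · refine hH i ?_
    rw [Finset.mem_Icc, ← abs_le] at h
    omega

theorem toLaurent_eq_sum {n : ℕ} {p : Polynomial ℝ} (hp : p.natDegree < n) :
    p.toLaurent = ∑ i ∈ Finset.range n, p.coeff i • T (i : ℤ) := by
  conv_lhs => rw [p.as_sum_range_C_mul_X_pow' hp]
  rw [map_sum]
  refine Finset.sum_congr rfl fun i _ => ?_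
  rw [Polynomial.toLaurent_C_mul_X_pow, smul_eq_C_mul]

theorem coeff_toLaurent_natCast (p : Polynomial ℝ) (i : ℕ) :
    p.toLaurent.coeff (i : ℤ) = p.coeff i := by
  rw [toLaurent_eq_sum (Nat.lt_succ_self _), AddMonoidAlgebra.coeff_sum, Finset.sum_apply']
  simp only [AddMonoidAlgebra.coeff_smul, Finsupp.smul_apply, T_apply, smul_eq_mul, mul_ite, mul_one,
    mul_zero, Nat.cast_inj, Finset.sum_ite_eq', Finset.mem_range]
  split_ifs with h
  · rfl
  · exact (Polynomial.coeff_eq_zero_of_natDegree_lt (by omega)).symm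

theorem coeff_toLaurent_neg (p : Polynomial ℝ) {i : ℤ} (hi : i < 0) :
    p.toLaurent.coeff i = 0 := by
  rw [toLaurent_eq_sum (Nat.lt_succ_self _), AddMonoidAlgebra.coeff_sum, Finset.sum_apply']
  refine Finset.sum_eq_zero fun j _ => ?_
  rw [AddMonoidAlgebra.coeff_smul, Finsupp.smul_apply, T_apply, if_neg (by omega), smul_zero]

theorem inv_eq_self_abs_zpow {ε : ℝˣ} (hε : ε⁻¹ = ε) (i : ℤ) : |((ε ^ i : ℝˣ) : ℝ)| = 1 := by
  have h : (ε ^ i) * (ε ^ i) = 1 := by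
    nth_rewrite 1 [← hε]
    rw [inv_zpow, inv_mul_cancel]
  have h' := congrArg (Units.val) h
  rw [Units.val_mul, Units.val_one] at h'
  rw [← abs_mul_self, abs_mul] at h'
  nlinarith [abs_nonneg ((ε ^ i : ℝˣ) : ℝ)]

/-! ### Moment sequences on a half-line and their generating series at 1 and -1 -/

/-- The symmetric partial sum `∑_{|k| < q} Λ (T k)`. -/
def symmSum (Λ : ℝ[T;T⁻¹] →ₗ[ℝ] ℝ) (q : ℕ) : ℝ :=
  ∑ k ∈ Finset.range q, (if k = 0 then 1 else 2) * Λ (T (k : ℤ))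

/-- One half of the sequence `Λ (T k)`. -/
def halfMoment (Λ : ℝ[T;T⁻¹] →ₗ[ℝ] ℝ) (k : ℤ) : ℝ :=
  if k < 0 then 0 else if k = 0 then Λ (T 0) / 2 else Λ (T k)

theorem symmSum_eq_halfMoment (Λ : ℝ[T;T⁻¹] →ₗ[ℝ] ℝ) (q : ℕ) :
    symmSum Λ q = 2 * ∑ k ∈ Finset.range q, halfMoment Λ k := by
  rw [symmSum, Finset.mul_sum]
  refine Finset.sum_congr rfl fun k _ => ?_
  rcases Nat.eq_zero_or_pos k with rfl | hk
  · simp [halfMoment]; ring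
  · have h1 : ¬ ((k : ℤ) < 0) := by omega
    have h2 : ¬ ((k : ℤ) = 0) := by omega
    rw [halfMoment, if_neg h1, if_neg h2, if_neg hk.ne']

theorem symmSum_one (Λ : ℝ[T;T⁻¹] →ₗ[ℝ] ℝ) : symmSum Λ 1 = Λ (T 0) := by simp [symmSum]

theorem symmSum_succ (Λ : ℝ[T;T⁻¹] →ₗ[ℝ] ℝ) (q : ℕ) :
    symmSum Λ (q + 2) = symmSum Λ (q + 1) + 2 * Λ (T ((q : ℤ) + 1)) := by
  rw [symmSum, Finset.sum_range_succ, ← symmSum]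
  simp

namespace IsReciprocalMoment

variable {H : ℝ[T;T⁻¹]} {Λ : ℝ[T;T⁻¹] →ₗ[ℝ] ℝ} (hΛ : IsReciprocalMoment H Λ)
  {n : ℕ} (hH : ∀ l : ℤ, (n : ℤ) < |l| → H.coeff l = 0)

include hΛ

theorem coeff_neg (l : ℤ) : H.coeff (-l) = H.coeff l := by
  rw [← invert_apply, hΛ.invert_eq]

theorem map_T_neg (k : ℤ) : Λ (T (-k)) = Λ (T k) := by
  rw [← invert_T, hΛ.map_invert]

theorem abs_map_T_le (k : ℤ) : |Λ (T k)| ≤ Λ (T 0) := by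
  have key : ∀ s : ℝ, s ^ 2 = 1 → 0 ≤ 2 * Λ (T 0) + 2 * s * Λ (T k) := by
    intro s hs
    have h := hΛ.nonneg (T 0 + s • T k)
    have e : (T 0 + s • T k : ℝ[T;T⁻¹]) * invert (T 0 + s • T k)
        = T 0 + s • T k + s • T (-k) + (s ^ 2) • T 0 := by
      have hT : (T k * T (-k) : ℝ[T;T⁻¹]) = 1 := by rw [← T_add]; simp
      rw [map_add, map_smul, invert_T, invert_T, neg_zero, T_zero, smul_eq_C_mul, smul_eq_C_mul,
        smul_eq_C_mul, map_pow]
      linear_combination (C s * C s) * hT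
    rw [e, map_add, map_add, map_add, map_smul, map_smul, map_smul, hΛ.map_T_neg, hs] at h
    simp only [smul_eq_mul] at h
    linarith
  have h1 := key 1 (by norm_num)
  have h2 := key (-1) (by norm_num)
  rw [abs_le]; constructor <;> linarith

include hH

/-- As H is even, it may be expanded in the z^{-l}, and the sum is Λ(H·z^i·P). -/
theorem sum_coeff_smul_T_sub (i : ℤ) (P : ℝ[T;T⁻¹]) :
    ∑ l ∈ Finset.Icc (-(n : ℤ)) n, H.coeff l * Λ (T (i - l) * P) = P.coeff (-i) := by
  have h1 : P.coeff (-i) = Λ (H * (P * T i)) := by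
    rw [hΛ.map_left_mul, coeff_mul_T]; simp
  have e : H = ∑ l ∈ Finset.Icc (-(n : ℤ)) n, H.coeff l • T (-l) := by
    conv_lhs => rw [← hΛ.invert_eq, laurent_eq_sum hH, map_sum]
    simp
  rw [h1]
  conv_rhs => rw [e, Finset.sum_mul, map_sum]
  refine Finset.sum_congr rfl fun l _ => ?_
  rw [smul_mul_assoc, map_smul, smul_eq_mul, T_sub]
  congr 2; ring

theorem sum_coeff_mul_map_T_sub (i : ℤ) :
    ∑ l ∈ Finset.Icc (-(n : ℤ)) n, H.coeff l * Λ (T (i - l)) = if i = 0 then 1 else 0 := by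
  have h := hΛ.sum_coeff_smul_T_sub hH i 1
  simp only [mul_one] at h
  rw [h, ← T_zero, T_apply]
  congr 1
  apply propext
  constructor <;> intro h <;> omega

theorem sum_coeff_mul_map_T_add (i : ℤ) :
    ∑ l ∈ Finset.Icc (-(n : ℤ)) n, H.coeff l * Λ (T (i + l)) = if i = 0 then 1 else 0 := by
  have h := hΛ.sum_coeff_mul_map_T_sub hH (-i)
  simp only [neg_eq_zero] at h
  rw [← h]
  refine Finset.sum_congr rfl fun l _ => ?_
  rw [← hΛ.map_T_neg (i + l), neg_add, sub_eq_add_neg]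

omit hΛ in
theorem laurentEval_eq_sum (ε : ℝˣ) :
    laurentEval ε H = ∑ l ∈ Finset.Icc (-(n : ℤ)) n, H.coeff l * (ε ^ l : ℝˣ) := by
  conv_lhs => rw [laurent_eq_sum hH, map_sum]
  refine Finset.sum_congr rfl fun l _ => ?_
  rw [smul_eq_C_mul, map_mul, laurentEval_C, laurentEval_T]

omit hΛ in
theorem sum_coeff_mul_zpow (ε : ℝˣ) (j : ℤ) :
    ∑ l ∈ Finset.Icc (-(n : ℤ)) n, H.coeff l * ((ε ^ (j + l) : ℝˣ) : ℝ)
      = laurentEval ε H * (ε ^ j : ℝˣ) := by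
  rw [laurentEval_eq_sum hH, Finset.sum_mul]
  refine Finset.sum_congr rfl fun l _ => ?_
  rw [zpow_add, Units.val_mul]; ring

variable (hμ : Tendsto (fun k : ℤ => Λ (T k)) atTop (𝓝 0))
include hμ

/-- `halfMoment` plus its reflection is the full moment sequence, which H convolves to δ; so ν(i) +
ν(-i) = δ(i). The weight ε^i is even, hence ∑ ν(i)ε^i = 1/2, and this is H(ε) times the limit. -/
theorem tendsto_sum_halfMoment {ε : ℝˣ} (hε : ε⁻¹ = ε) (hpos : 0 < laurentEval ε H) :
    Tendsto (fun M : ℕ => ∑ j ∈ Finset.range M, halfMoment Λ j * ((ε ^ (j : ℤ) : ℝˣ) : ℝ)) atTop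
      (𝓝 (1 / (2 * laurentEval ε H))) := by
  have hκ : Tendsto (halfMoment Λ) atTop (𝓝 0) := by
    refine hμ.congr' ?_
    filter_upwards [eventually_gt_atTop 0] with k hk
    rw [halfMoment, if_neg (by omega), if_neg (by omega)]
  set ν : ℤ → ℝ := fun i => ∑ l ∈ Finset.Icc (-(n : ℤ)) n, H.coeff l * halfMoment Λ (i - l) with hν
  have hν0 : ∀ i : ℤ, n < i → ν i = 0 := by
    intro i hi
    have : ν i = ∑ l ∈ Finset.Icc (-(n : ℤ)) n, H.coeff l * Λ (T (i - l)) := by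
      refine Finset.sum_congr rfl fun l hl => ?_
      rw [Finset.mem_Icc] at hl
      rw [halfMoment, if_neg (by omega), if_neg (by omega)]
    rw [this, hΛ.sum_coeff_mul_map_T_sub hH, if_neg (by omega)]
  have hνν : ∀ i : ℤ, ν i + ν (-i) = if i = 0 then 1 else 0 := by
    intro i
    have e : ν (-i) = ∑ l ∈ Finset.Icc (-(n : ℤ)) n, H.coeff l * halfMoment Λ (-(i - l)) := by
      refine Finset.sum_nbij' (fun l => -l) (fun l => -l) ?_ ?_ (by simp) (by simp) ?_
      · intro l hl; simp only [Finset.mem_Icc] at hl ⊢; omega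
      · intro l hl; simp only [Finset.mem_Icc] at hl ⊢; omega
      · intro l _; rw [hΛ.coeff_neg]; congr 2; ring
    rw [e, hν, ← Finset.sum_add_distrib, ← hΛ.sum_coeff_mul_map_T_sub hH i]
    refine Finset.sum_congr rfl fun l _ => ?_
    rw [← mul_add]
    congr 1
    rcases lt_trichotomy (i - l) 0 with h | h | h
    · rw [halfMoment, halfMoment, if_pos h, if_neg (by omega), if_neg (by omega), zero_add,
        hΛ.map_T_neg]
    · rw [h]; simp [halfMoment]
    · rw [halfMoment, halfMoment, if_neg (by omega), if_neg (by omega), if_pos (by omega), add_zero]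
  have hlim := tendsto_sum_mul_conv (H := fun l => H.coeff l) (κ := halfMoment Λ)
    (w := fun i => ((ε ^ i : ℝˣ) : ℝ)) (B := 1) (fun j hj => by rw [halfMoment, if_pos hj]) hκ
    (fun i => (inv_eq_self_abs_zpow hε i).le) (ν := ν) (fun i => rfl) hν0
  have hinv : ∀ i : ℤ, (ε ^ (-i) : ℝˣ) = ε ^ i := fun i => by rw [zpow_neg, ← inv_zpow, hε]
  have hsum : ∑ i ∈ Finset.Icc (-(n : ℤ)) n, ν i * ((ε ^ i : ℝˣ) : ℝ) = 1 / 2 := by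
    have e : ∑ i ∈ Finset.Icc (-(n : ℤ)) n, ν i * ((ε ^ i : ℝˣ) : ℝ)
        = ∑ i ∈ Finset.Icc (-(n : ℤ)) n, ν (-i) * ((ε ^ i : ℝˣ) : ℝ) := by
      refine Finset.sum_nbij' (fun l => -l) (fun l => -l) ?_ ?_ (by simp) (by simp) ?_
      · intro l hl; simp only [Finset.mem_Icc] at hl ⊢; omega
      · intro l hl; simp only [Finset.mem_Icc] at hl ⊢; omega
      · intro l _; rw [hinv, neg_neg]
    have e2 : ∑ i ∈ Finset.Icc (-(n : ℤ)) n, ν i * ((ε ^ i : ℝˣ) : ℝ)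
        + ∑ i ∈ Finset.Icc (-(n : ℤ)) n, ν i * ((ε ^ i : ℝˣ) : ℝ) = 1 := by
      nth_rewrite 2 [e]
      rw [← Finset.sum_add_distrib]
      simp only [← add_mul, hνν, ite_mul, one_mul, zero_mul, Finset.sum_ite_eq', zpow_zero,
        Units.val_one]
      rw [if_pos (by simp)]
    linarith
  rw [hsum] at hlim
  simp only [sum_coeff_mul_zpow hH] at hlim
  have h2 := hlim.const_mul (1 / laurentEval ε H)
  have e : 1 / laurentEval ε H * (1 / 2) = 1 / (2 * laurentEval ε H) := by
    field_simp
  rw [e] at h2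
  refine h2.congr fun M => ?_
  rw [Finset.mul_sum]
  refine Finset.sum_congr rfl fun j _ => ?_
  field_simp

theorem tendsto_symmSum (hpos : 0 < laurentEval 1 H) :
    Tendsto (symmSum Λ) atTop (𝓝 (1 / laurentEval 1 H)) := by
  have h := (hΛ.tendsto_sum_halfMoment hH hμ (ε := 1) (by simp) hpos).const_mul 2
  have e : 2 * (1 / (2 * laurentEval 1 H)) = 1 / laurentEval 1 H := by field_simp
  rw [e] at h
  refine h.congr fun M => ?_
  rw [symmSum_eq_halfMoment]
  simp

/-- Let `p` be a polynomial, and let `κ` be the sequence of the moments of `p` on the positive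
half-line, with `κ 0` arbitrary. If the convolution of `H` and `κ` agrees with `p` on the negative
half-line, then `κ` differs from the moments of `p` by those of a polynomial `N` in the opposite
variable, and the values of `N` at `1` and `-1` are limits of partial sums. -/
theorem exists_polynomial {p : Polynomial ℝ} (hp : p.natDegree ≤ n) {κ : ℤ → ℝ}
    (hκ0 : ∀ j < 0, κ j = 0) (hκ1 : ∀ j > 0, κ j = Λ (T j * p.toLaurent))
    (hneg : ∀ i : ℕ, 0 < i → i ≤ n →
      ∑ l ∈ Finset.Icc (-(n : ℤ)) n, H.coeff l * κ (-i - l) = p.coeff i) :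
    ∃ N : Polynomial ℝ, (∀ k : ℤ, Λ (T (-k) * N.toLaurent) = Λ (T k * p.toLaurent) - κ k) ∧
      ∀ ε : ℝˣ, ε⁻¹ = ε → Tendsto (fun M : ℕ => laurentEval ε H *
        ∑ j ∈ Finset.range M, κ j * ((ε ^ (j : ℤ) : ℝˣ) : ℝ)) atTop
        (𝓝 (p.eval (ε : ℝ) - N.eval (ε : ℝ))) := by
  have hΛp : ∀ k : ℤ, Λ (T k * p.toLaurent)
      = ∑ i ∈ Finset.range (n + 1), p.coeff i * Λ (T (k + i)) := by
    intro k
    rw [toLaurent_eq_sum (Nat.lt_succ_of_le hp), Finset.mul_sum, map_sum]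
    refine Finset.sum_congr rfl fun i _ => ?_
    rw [mul_smul_comm, map_smul, T_add, smul_eq_mul]
  have hκ : Tendsto κ atTop (𝓝 0) := by
    have : Tendsto (fun k : ℤ => ∑ i ∈ Finset.range (n + 1), p.coeff i * Λ (T (k + i))) atTop
        (𝓝 (∑ i ∈ Finset.range (n + 1), p.coeff i * 0)) :=
      tendsto_finsetSum _ fun i _ => (hμ.comp
        (tendsto_atTop_add_const_right _ _ tendsto_id)).const_mul _
    simp only [mul_zero, Finset.sum_const_zero] at this
    refine this.congr' ?_
    filter_upwards [eventually_gt_atTop 0] with k hk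
    rw [hκ1 k hk, hΛp]
  set ν : ℤ → ℝ := fun i => ∑ l ∈ Finset.Icc (-(n : ℤ)) n, H.coeff l * κ (i - l) with hν
  have hν0 : ∀ i : ℤ, n < i → ν i = 0 := by
    intro i hi
    have : ν i = ∑ l ∈ Finset.Icc (-(n : ℤ)) n, H.coeff l * Λ (T (i - l) * p.toLaurent) := by
      refine Finset.sum_congr rfl fun l hl => ?_
      rw [Finset.mem_Icc] at hl
      rw [hκ1 _ (by omega)]
    rw [this, hΛ.sum_coeff_smul_T_sub hH, coeff_toLaurent_neg _ (by omega)]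
  -- In generating series Hκ = p(1/z) - N(z): the negative powers come from `hneg`, and `a` collects
  -- the others, including the constant term of p.
  set a : ℕ → ℝ := fun i => (if i = 0 then p.coeff 0 else 0) - ν i with ha
  set N : Polynomial ℝ := ∑ i ∈ Finset.range (n + 1), Polynomial.C (a i) * Polynomial.X ^ i with hN
  have hlim : ∀ (w : ℤ → ℝ) (B : ℝ), (∀ i, |w i| ≤ B) →
      Tendsto (fun M : ℕ => ∑ j ∈ Finset.range M, κ j *
        ∑ l ∈ Finset.Icc (-(n : ℤ)) n, H.coeff l * w (j + l)) atTop
      (𝓝 (∑ i ∈ Finset.range (n + 1), p.coeff i * w (-i)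
        - ∑ i ∈ Finset.range (n + 1), a i * w i)) := by
    intro w B hB
    have h := tendsto_sum_mul_conv (H := fun l => H.coeff l) hκ0 hκ hB (ν := ν)
      (fun i => rfl) hν0
    have e : ∑ i ∈ Finset.Icc (-(n : ℤ)) n, ν i * w i
        = ∑ i ∈ Finset.range (n + 1), p.coeff i * w (-i)
        - ∑ i ∈ Finset.range (n + 1), a i * w i := by
      rw [sum_Icc_neg_int, Finset.sum_range_succ', Finset.sum_range_succ' (fun i => p.coeff i * _)]
      have e1 : ∑ i ∈ Finset.range n, ν (-((i + 1 : ℕ) : ℤ)) * w (-((i + 1 : ℕ) : ℤ))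
          = ∑ i ∈ Finset.range n, p.coeff (i + 1) * w (-((i + 1 : ℕ) : ℤ)) := by
        refine Finset.sum_congr rfl fun i hi => ?_
        rw [Finset.mem_range] at hi
        rw [← hneg (i + 1) (by omega) (by omega)]
      have e2 : ∑ i ∈ Finset.range (n + 1), a i * w i
          = p.coeff 0 * w 0 - ∑ i ∈ Finset.range (n + 1), ν i * w i := by
        simp only [ha, sub_mul, Finset.sum_sub_distrib, ite_mul, zero_mul, Finset.sum_ite_eq',
          Finset.mem_range]
        simp
      rw [e1, e2]
      simp
      ring
    rwa [e] at h
  have hΛN : ∀ k : ℤ, Λ (T k * N.toLaurent)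
      = ∑ i ∈ Finset.range (n + 1), a i * Λ (T (k + i)) := by
    intro k
    rw [hN, map_sum, Finset.mul_sum, map_sum]
    refine Finset.sum_congr rfl fun i _ => ?_
    rw [Polynomial.toLaurent_C_mul_X_pow, ← smul_eq_C_mul, mul_smul_comm, map_smul, T_add,
      smul_eq_mul]
  refine ⟨N, fun k => ?_, fun ε hε => ?_⟩
  -- Convolved with H, this weight becomes the indicator of j = k, so the partial sums are
  -- eventually κ k.
  · have h := hlim (fun i => Λ (T (i - k))) (Λ (T 0)) (fun i => hΛ.abs_map_T_le _)
    have e : ∀ j : ℕ, ∑ l ∈ Finset.Icc (-(n : ℤ)) n, H.coeff l * Λ (T ((j : ℤ) + l - k))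
        = if (j : ℤ) = k then 1 else 0 := by
      intro j
      have := hΛ.sum_coeff_mul_map_T_add hH ((j : ℤ) - k)
      simp only [sub_eq_zero] at this
      rw [← this]
      refine Finset.sum_congr rfl fun l _ => ?_
      congr 3; ring
    simp only [e] at h
    have h2 : Tendsto (fun M : ℕ => ∑ j ∈ Finset.range M, κ j * if (j : ℤ) = k then 1 else 0) atTop
        (𝓝 (κ k)) := by
      refine tendsto_const_nhds.congr' ?_
      filter_upwards [eventually_gt_atTop k.toNat] with M hM
      rcases lt_or_ge k 0 with hk | hk
      · rw [hκ0 k hk, Finset.sum_eq_zero]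
        intro j _
        rw [if_neg (by omega), mul_zero]
      · obtain ⟨q, rfl⟩ := Int.eq_ofNat_of_zero_le hk
        rw [Finset.sum_eq_single q]
        · simp
        · intro j _ hj
          rw [if_neg (by exact_mod_cast hj), mul_zero]
        · intro hq
          rw [Finset.mem_range] at hq
          simp at hM
          omega
    have h3 := tendsto_nhds_unique h2 h
    rw [h3, hΛp, hΛN]
    have e3 : ∀ i : ℕ, Λ (T (-(i : ℤ) - k)) = Λ (T (k + i)) := by
      intro i
      rw [← hΛ.map_T_neg]
      congr 2; ring
    have e4 : ∀ i : ℕ, Λ (T ((i : ℤ) - k)) = Λ (T (-k + i)) := by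
      intro i
      congr 2; ring
    simp only [e3, e4]
    ring
  · have h := hlim (fun i => ((ε ^ i : ℝˣ) : ℝ)) 1 (fun i => (inv_eq_self_abs_zpow hε i).le)
    have hinv : ∀ i : ℤ, (ε ^ (-i) : ℝˣ) = ε ^ i := fun i => by rw [zpow_neg, ← inv_zpow, hε]
    have e1 : p.eval (ε : ℝ) = ∑ i ∈ Finset.range (n + 1), p.coeff i * ((ε ^ (-(i : ℤ)) : ℝˣ) : ℝ) := by
      rw [Polynomial.eval_eq_sum_range' (Nat.lt_succ_of_le hp)]
      refine Finset.sum_congr rfl fun i _ => ?_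
      rw [hinv, zpow_natCast, Units.val_pow_eq_pow_val]
    have e2 : N.eval (ε : ℝ) = ∑ i ∈ Finset.range (n + 1), a i * ((ε ^ (i : ℤ) : ℝˣ) : ℝ) := by
      rw [hN, Polynomial.eval_finsetSum]
      refine Finset.sum_congr rfl fun i _ => ?_
      simp
    rw [e1, e2]
    refine h.congr fun M => ?_
    rw [Finset.mul_sum]
    refine Finset.sum_congr rfl fun j _ => ?_
    rw [sum_coeff_mul_zpow hH]
    ring

end IsReciprocalMoment

/-! ### The kernel equation and its generating polynomial -/

namespace IsReciprocalMoment

/-- The generating polynomial of the image of the vector `(g, b)`. -/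
def genPoly (n : ℕ) (g : ℕ → ℝ) (a : ℝ) : Polynomial ℝ :=
  ∑ j ∈ Finset.range n, Polynomial.C (2 * g j) * (Polynomial.X ^ (j + 1) + Polynomial.X ^ j)
    + Polynomial.C a

theorem natDegree_genPoly_le (n : ℕ) (g : ℕ → ℝ) (a : ℝ) : (genPoly n g a).natDegree ≤ n := by
  refine (Polynomial.natDegree_add_le _ _).trans (max_le ?_ (by simp))
  refine Polynomial.natDegree_sum_le_of_forall_le _ _ fun j hj => ?_
  rw [Finset.mem_range] at hj
  refine (Polynomial.natDegree_C_mul_le _ _).trans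
    ((Polynomial.natDegree_add_le _ _).trans (max_le ?_ ?_))
  · rw [Polynomial.natDegree_X_pow]; omega
  · rw [Polynomial.natDegree_X_pow]; omega

theorem coeff_genPoly_succ {n : ℕ} {g : ℕ → ℝ} (hg : ∀ i, n ≤ i → g i = 0) (a : ℝ) (i : ℕ) :
    (genPoly n g a).coeff (i + 1) = 2 * (g i + g (i + 1)) := by
  have e : ∀ j : ℕ, (if i + 1 = j + 1 then (1 : ℝ) else 0) = if j = i then 1 else 0 := by
    intro j; split_ifs <;> first | rfl | omega
  simp only [genPoly, Polynomial.coeff_add, Polynomial.finsetSum_coeff, Polynomial.coeff_C_mul,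
    Polynomial.coeff_X_pow, Polynomial.coeff_C_succ, e, mul_add, mul_ite, mul_one, mul_zero,
    Finset.sum_add_distrib, Finset.sum_ite_eq, Finset.sum_ite_eq', Finset.mem_range, add_zero]
  congr 1
  · split_ifs with h
    · rfl
    · rw [hg i (by omega), mul_zero]
  · split_ifs with h
    · rfl
    · rw [hg _ (by omega), mul_zero]

theorem eval_genPoly (n : ℕ) (g : ℕ → ℝ) (a x : ℝ) :
    (genPoly n g a).eval x = ∑ j ∈ Finset.range n, 2 * g j * (x ^ (j + 1) + x ^ j) + a := by
  simp [genPoly, Polynomial.eval_finsetSum]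

theorem map_T_mul_genPoly (Λ : ℝ[T;T⁻¹] →ₗ[ℝ] ℝ) (n : ℕ) (g : ℕ → ℝ) (a : ℝ) (k : ℤ) :
    Λ (T k * (genPoly n g a).toLaurent)
      = ∑ j ∈ Finset.range n, 2 * g j * (Λ (T (k + j + 1)) + Λ (T (k + j))) + a * Λ (T k) := by
  have e1 : T k * (genPoly n g a).toLaurent
      = ∑ j ∈ Finset.range n, (2 * g j) • (T (k + j + 1) + T (k + j)) + a • T k := by
    rw [genPoly, map_add, map_sum, mul_add, Finset.mul_sum, Polynomial.toLaurent_C, smul_eq_C_mul,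
      mul_comm (T k) (C a)]
    congr 1
    refine Finset.sum_congr rfl fun j _ => ?_
    rw [map_mul, map_add, Polynomial.toLaurent_C, Polynomial.toLaurent_X_pow,
      Polynomial.toLaurent_X_pow, smul_eq_C_mul, add_assoc k, T_add k, T_add k]
    push_cast
    ring
  rw [e1, map_add, map_sum, map_smul, smul_eq_mul]
  congr 1
  refine Finset.sum_congr rfl fun j _ => ?_
  rw [map_smul, map_add, smul_eq_mul]

/-- Abel summation, f being the sequence of partial sums of κ. -/
theorem sum_sub_mul_eq (H κ : ℤ → ℝ) (f : ℕ → ℝ) (h0 : κ 0 = f 0)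
    (hf : ∀ i : ℕ, f (i + 1) - f i = κ (i + 1)) (I K : ℕ) :
    ∑ j ∈ Finset.range (K + 1), (H (I + j) - H (I + j + 1)) * f j
      = ∑ j ∈ Finset.range (K + 1), H (I + j) * κ j - H (I + K + 1) * f K := by
  induction K with
  | zero => simp [h0]; ring
  | succ K ih =>
    rw [Finset.sum_range_succ, ih, Finset.sum_range_succ _ (K + 1)]
    have := hf K
    push_cast
    rw [← this]
    simp only [← add_assoc]
    ring

variable {H : ℝ[T;T⁻¹]} {Λ : ℝ[T;T⁻¹] →ₗ[ℝ] ℝ} (hΛ : IsReciprocalMoment H Λ)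
  {n : ℕ} (hH : ∀ l : ℤ, (n : ℤ) < |l| → H.coeff l = 0)
include hΛ hH

omit hH in
theorem sum_coeff_mul_eq_range {κ : ℤ → ℝ} (hκ0 : ∀ j < 0, κ j = 0) {I : ℕ} (hI : I ≤ n) :
    ∑ l ∈ Finset.Icc (-(n : ℤ)) n, H.coeff l * κ (-I - l)
      = ∑ j ∈ Finset.range (n - I + 1), H.coeff (I + j) * κ j := by
  symm
  refine Finset.sum_of_injOn (fun j : ℕ => -(I : ℤ) - j) (fun a _ b _ h => by simpa using h)
    (fun j hj => ?_) (fun l hl hl' => ?_) (fun j _ => ?_)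
  · simp only [Finset.coe_range, Set.mem_Iio, Finset.coe_Icc, Set.mem_Icc] at hj ⊢; omega
  · rw [hκ0, mul_zero]
    simp only [Finset.mem_Icc] at hl
    by_contra h
    refine hl' ⟨(-(I : ℤ) - l).toNat, ?_, ?_⟩
    · simp only [Finset.coe_range, Set.mem_Iio]; omega
    · simp only; omega
  · rw [← hΛ.coeff_neg]
    congr 2 <;> ring

variable (hμ : Tendsto (fun k : ℤ => Λ (T k)) atTop (𝓝 0))
include hμ

/-- Triviality of the kernel of the finite section of `1 - XY`. -/
theorem eq_zero_of_mem_kernel (h1 : 0 < laurentEval 1 H) (h0 : 0 < laurentEval (-1) H)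
    {c : ℕ → ℝ} (hc : ∀ k : ℕ, 2 * (c k + c (k + 1)) = H.coeff k - H.coeff (k + 1))
    (hcn : ∀ k, n < k → c k = 0) {f g : ℕ → ℝ} {b : ℝ}
    (hf : ∀ i, f i = ∑ j ∈ Finset.range n, g j * (symmSum Λ (i + j + 1) + symmSum Λ (i + j + 2))
      + b * (√(laurentEval (-1) H) * symmSum Λ (i + 1) - 1 / √(laurentEval 1 H)))
    (hg : ∀ i, g i = ∑ j ∈ Finset.range n, c (i + j + 1) * f j)
    (hb : (1 + √(laurentEval (-1) H) / √(laurentEval 1 H)) * b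
      = ∑ j ∈ Finset.range n,
        g j * (√(laurentEval (-1) H) * symmSum Λ (j + 1) - 1 / √(laurentEval 1 H))) :
    (∀ i, g i = 0) ∧ b = 0 := by
  set σ0 := √(laurentEval (-1) H) with hσ0
  set σ1 := √(laurentEval 1 H) with hσ1
  have hs0 : 0 < σ0 := Real.sqrt_pos.2 h0
  have hs1 : 0 < σ1 := Real.sqrt_pos.2 h1
  have hq0 : σ0 ^ 2 = laurentEval (-1) H := Real.sq_sqrt h0.le
  have hq1 : σ1 ^ 2 = laurentEval 1 H := Real.sq_sqrt h1.le
  have hgn : ∀ i, n ≤ i → g i = 0 := by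
    intro i hi
    rw [hg]
    exact Finset.sum_eq_zero fun j _ => by rw [hcn _ (by omega), zero_mul]
  -- The constant term 2bσ₀ accounts for the increments 2bσ₀Λ(z^{i+1}) of the b-term of f.
  set p := genPoly n g (2 * b * σ0) with hp
  -- The value f 0 at 0 makes f the sequence of partial sums of κ.
  set κ : ℤ → ℝ := fun j => if j < 0 then 0 else if j = 0 then f 0 else Λ (T j * p.toLaurent) with hκ
  have hκ0 : ∀ j < 0, κ j = 0 := fun j hj => by simp only [hκ, if_pos hj]
  have hκz : κ 0 = f 0 := by simp [hκ]
  have hκ1 : ∀ j > 0, κ j = Λ (T j * p.toLaurent) := fun j hj => by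
    simp only [hκ]; rw [if_neg (by omega), if_neg (by omega)]
  have hfdiff : ∀ i : ℕ, f (i + 1) - f i = κ (i + 1) := by
    intro i
    rw [hκ1 _ (by omega), hp, map_T_mul_genPoly, hf, hf, symmSum_succ Λ i]
    have e : ∀ j : ℕ, g j * (symmSum Λ (i + 1 + j + 1) + symmSum Λ (i + 1 + j + 2))
        = g j * (symmSum Λ (i + j + 1) + symmSum Λ (i + j + 2))
        + 2 * g j * (Λ (T ((i : ℤ) + 1 + j + 1)) + Λ (T ((i : ℤ) + 1 + j))) := by
      intro j
      have e1 := symmSum_succ Λ (i + j)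
      have e2 := symmSum_succ Λ (i + j + 1)
      rw [show i + 1 + j + 1 = i + j + 2 by ring, show i + 1 + j + 2 = i + j + 1 + 2 by ring, e2, e1]
      push_cast
      rw [show (i : ℤ) + j + 1 + 1 = i + 1 + j + 1 by ring, show (i : ℤ) + j + 1 = i + 1 + j by ring]
      ring
    simp only [e, Finset.sum_add_distrib]
    ring
  -- Abel summation replaces κ by f and H by its differences 2(c_k + c_{k+1}); the equation for g
  -- then yields 2(g_{i-1} + g_i), the coefficient of p.
  have hneg : ∀ i : ℕ, 0 < i → i ≤ n →
      ∑ l ∈ Finset.Icc (-(n : ℤ)) n, H.coeff l * κ (-i - l) = p.coeff i := by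
    intro i hi hin
    rw [hΛ.sum_coeff_mul_eq_range hκ0 hin]
    obtain ⟨i, rfl⟩ : ∃ k, i = k + 1 := ⟨i - 1, by omega⟩
    have h := sum_sub_mul_eq (fun l => H.coeff l) κ f hκz hfdiff (i + 1) (n - (i + 1))
    have hz : H.coeff (((i + 1 : ℕ) : ℤ) + ((n - (i + 1) : ℕ) : ℤ) + 1) = 0 :=
      hH _ (by rw [abs_of_nonneg (by omega)]; omega)
    rw [hz, zero_mul, sub_zero] at h
    rw [← h, hp, coeff_genPoly_succ hgn, hg, hg, ← Finset.sum_add_distrib, Finset.mul_sum]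
    refine Finset.sum_subset_zero_on_sdiff (fun j hj => ?_) (fun j hj => ?_) (fun j _ => ?_)
    · simp only [Finset.mem_range] at hj ⊢; omega
    · simp only [Finset.mem_sdiff, Finset.mem_range] at hj
      rw [hcn (i + j + 1) (by omega), hcn (i + 1 + j + 1) (by omega)]
      simp
    · have := hc (i + j + 1)
      push_cast at this ⊢
      rw [show (i : ℤ) + 1 + j = i + j + 1 by ring, show i + 1 + j + 1 = i + j + 1 + 1 by ring,
        ← this]
      ring
  obtain ⟨N, hN, hNlim⟩ := hΛ.exists_polynomial hH hμ (natDegree_genPoly_le n g _) hκ0 hκ1 hneg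
  have hNW : ∀ k : ℕ, Λ (T (-(k + 1)) * N.toLaurent) = 0 := by
    intro k
    rw [hN, hκ1 _ (by omega), sub_self]
  set G := ∑ j ∈ Finset.range n, g j with hG
  set Z := ∑ j ∈ Finset.range n, g j * symmSum Λ (j + 1) with hZ
  have hS := hΛ.tendsto_symmSum hH hμ h1
  have hp1 : p.eval 1 = 4 * G + 2 * b * σ0 := by
    rw [hp, eval_genPoly, hG, Finset.mul_sum]
    congr 1
    refine Finset.sum_congr rfl fun j _ => by simp; ring
  have hp0 : p.eval (-1) = 2 * b * σ0 := by
    rw [hp, eval_genPoly, Finset.sum_eq_zero, zero_add]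
    intro j _
    ring
  -- The series of κ at 1 sums to lim f, which is known because the symmetric sums tend to 1/H(1).
  have hN1 : N.eval 1 = p.eval 1 / 2 + b * σ1 := by
    have hl1 := hNlim 1 (by simp)
    have hsum : ∀ M : ℕ, ∑ j ∈ Finset.range (M + 1), κ j = f M := by
      intro M
      induction M with
      | zero => simp [hκz]
      | succ M ih =>
        rw [Finset.sum_range_succ, ih]
        push_cast
        rw [← hfdiff]; ring
    have hflim : Tendsto f atTop (𝓝 (∑ j ∈ Finset.range n,
        g j * (1 / laurentEval 1 H + 1 / laurentEval 1 H)
        + b * (σ0 * (1 / laurentEval 1 H) - 1 / σ1))) := by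
      have : f = fun i => ∑ j ∈ Finset.range n,
          g j * (symmSum Λ (i + j + 1) + symmSum Λ (i + j + 2))
          + b * (σ0 * symmSum Λ (i + 1) - 1 / σ1) := funext hf
      rw [this]
      have hsh : ∀ r : ℕ, Tendsto (fun i : ℕ => symmSum Λ (i + r)) atTop
          (𝓝 (1 / laurentEval 1 H)) := fun r => hS.comp (tendsto_add_atTop_nat r)
      refine Tendsto.add (tendsto_finsetSum _ fun j _ => ?_) ?_
      · exact ((hsh (j + 1)).add (hsh (j + 2))).const_mul _
      · exact (((hsh 1).const_mul _).sub_const _).const_mul _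
    have h2 := hl1.comp (tendsto_add_atTop_nat 1)
    simp only [Function.comp_def, one_zpow, Units.val_one, mul_one, hsum] at h2
    have h3 := tendsto_nhds_unique h2 (hflim.const_mul (laurentEval 1 H))
    rw [← Finset.sum_mul, ← hG, ← hq1] at h3
    have e : σ1 ^ 2 * (G * (1 / σ1 ^ 2 + 1 / σ1 ^ 2) + b * (σ0 * (1 / σ1 ^ 2) - 1 / σ1))
        = 2 * G + b * σ0 - b * σ1 := by field_simp; ring
    rw [e] at h3
    linarith
  -- At -1 the factors z^{j+1} + z^j make the alternating sums telescope; only the constant term of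
  -- p leaves a series, that of `halfMoment`.
  have hN0 : N.eval (-1) = 2 * b * σ0 - σ0 ^ 2 * (2 * Z + b / σ0 - b / σ1) := by
    have hl0 := hNlim (-1) (by simp)
    have hP := hΛ.tendsto_sum_halfMoment hH hμ (ε := -1) (by simp) h0
    have hz : ∀ j : ℕ, (((-1 : ℝˣ) ^ (j : ℤ) : ℝˣ) : ℝ) = (-1) ^ j := by
      intro j; rw [zpow_natCast]; simp
    simp only [hz] at hl0 hP
    have hform : ∀ M : ℕ, ∑ j ∈ Finset.range (M + 1), κ j * (-1) ^ j
        = f 0 + ∑ j ∈ Finset.range n, 2 * g j * (-Λ (T ((j : ℤ) + 1))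
            + (-1) ^ M * Λ (T ((M : ℤ) + j + 1)))
          + 2 * b * σ0 * (∑ j ∈ Finset.range (M + 1), halfMoment Λ j * (-1) ^ j - Λ (T 0) / 2) := by
      intro M
      induction M with
      | zero => simp [hκz, halfMoment]
      | succ M ih =>
        rw [Finset.sum_range_succ, ih, Finset.sum_range_succ _ (M + 1), hκ1 _ (by omega), hp,
          map_T_mul_genPoly]
        have hm : halfMoment Λ ((M + 1 : ℕ) : ℤ) = Λ (T ((M + 1 : ℕ) : ℤ)) := by
          rw [halfMoment, if_neg (by omega), if_neg (by omega)]
        rw [hm]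
        have e : ∀ j : ℕ, 2 * g j * (-Λ (T ((j : ℤ) + 1))
            + (-1) ^ (M + 1) * Λ (T (((M + 1 : ℕ) : ℤ) + j + 1)))
            = 2 * g j * (-Λ (T ((j : ℤ) + 1)) + (-1) ^ M * Λ (T ((M : ℤ) + j + 1)))
            + 2 * g j * (Λ (T (((M + 1 : ℕ) : ℤ) + j + 1)) + Λ (T (((M + 1 : ℕ) : ℤ) + j)))
              * (-1) ^ (M + 1) := by
          intro j
          rw [show ((M + 1 : ℕ) : ℤ) + j = (M : ℤ) + j + 1 by push_cast; ring]
          ring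
        simp only [e, Finset.sum_add_distrib, ← Finset.sum_mul]
        ring
    have hlim : Tendsto (fun M : ℕ => ∑ j ∈ Finset.range (M + 1), κ j * (-1) ^ j) atTop
        (𝓝 (f 0 + ∑ j ∈ Finset.range n, 2 * g j * (-Λ (T ((j : ℤ) + 1)) + 0)
          + 2 * b * σ0 * (1 / (2 * laurentEval (-1) H) - Λ (T 0) / 2))) := by
      simp only [hform]
      refine Tendsto.add (Tendsto.add tendsto_const_nhds (tendsto_finsetSum _ fun j _ => ?_)) ?_
      · refine Tendsto.const_mul _ (Tendsto.add tendsto_const_nhds ?_)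
        have h : Tendsto (fun M : ℕ => Λ (T ((M : ℤ) + j + 1))) atTop (𝓝 0) :=
          hμ.comp (tendsto_atTop_add_const_right _ _
            (tendsto_atTop_add_const_right _ _ tendsto_natCast_atTop_atTop))
        refine squeeze_zero_norm (a := fun M : ℕ => |Λ (T ((M : ℤ) + j + 1))|) (fun M => ?_) ?_
        · rw [norm_mul, norm_pow, norm_neg, norm_one, one_pow, one_mul, Real.norm_eq_abs]
        · simpa using h.abs
      · exact (((hP.comp (tendsto_add_atTop_nat 1))).sub_const _).const_mul _
    have h3 := tendsto_nhds_unique (hl0.comp (tendsto_add_atTop_nat 1))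
      (hlim.const_mul (laurentEval (-1) H))
    have hf0 : f 0 = 2 * Z + ∑ j ∈ Finset.range n, 2 * g j * Λ (T ((j : ℤ) + 1))
        + b * (σ0 * Λ (T 0) - 1 / σ1) := by
      rw [hf, hZ, Finset.mul_sum, ← Finset.sum_add_distrib, zero_add, symmSum_one]
      congr 1
      refine Finset.sum_congr rfl fun j _ => ?_
      rw [zero_add, symmSum_succ]; ring
    have e1 : ∑ j ∈ Finset.range n, 2 * g j * (-Λ (T ((j : ℤ) + 1)) + 0)
        = - ∑ j ∈ Finset.range n, 2 * g j * Λ (T ((j : ℤ) + 1)) := by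
      rw [← Finset.sum_neg_distrib]
      exact Finset.sum_congr rfl fun j _ => by ring
    rw [e1, hf0, ← hq0] at h3
    have e2 : σ0 ^ 2 * (2 * Z + ∑ j ∈ Finset.range n, 2 * g j * Λ (T ((j : ℤ) + 1))
        + b * (σ0 * Λ (T 0) - 1 / σ1) + -∑ j ∈ Finset.range n, 2 * g j * Λ (T ((j : ℤ) + 1))
        + 2 * b * σ0 * (1 / (2 * σ0 ^ 2) - Λ (T 0) / 2))
        = σ0 ^ 2 * (2 * Z + b / σ0 - b / σ1) := by field_simp; ring
    rw [e2] at h3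
    simp only [Units.val_neg, Units.val_one] at h3
    rw [hp0] at h3
    linarith
  have hW := hΛ.sqrt_mul_eval hNW h1 h0
  rw [← hσ0, ← hσ1] at hW
  have hb' : (1 + σ0 / σ1) * b = σ0 * Z - G / σ1 := by
    rw [hb, hZ, hG, Finset.mul_sum, Finset.sum_div, ← Finset.sum_sub_distrib]
    exact Finset.sum_congr rfl fun j _ => by ring
  -- Eliminating G and Z turns the equation for b into N(1)/σ₁ + N(-1)/σ₀ = 0, while orthogonality
  -- of N says that these two terms are equal.
  have hNz : N.eval 1 = 0 := by
    rw [hp1] at hN1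
    have hGe : G = (N.eval 1 - b * σ0 - b * σ1) / 2 := by linarith
    have hZe : σ0 * Z = (b + b * σ0 / σ1 - N.eval (-1) / σ0) / 2 := by
      rw [hN0]; field_simp; ring
    rw [hGe, hZe] at hb'
    have h5 : N.eval 1 / σ1 + N.eval (-1) / σ0 = 0 := by
      field_simp at hb' ⊢
      linarith
    have h6 : N.eval 1 / σ1 = N.eval (-1) / σ0 := by
      field_simp
      linarith
    have h7 : N.eval 1 / σ1 = 0 := by linarith
    exact (div_eq_zero_iff.1 h7).resolve_right hs1.ne'
  have hN00 : N = 0 := by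
    by_contra hne
    exact hΛ.eval_ne_zero hNW hne (t := 1) (by norm_num) hNz
  -- With N = 0 the moments of p are κ at every index, and κ vanishes at negative ones.
  have hpW : ∀ k : ℕ, Λ (T (-(k + 1)) * p.toLaurent) = 0 := by
    intro k
    have := hN (-(k + 1))
    rw [hκ0 _ (by omega), hN00] at this
    simpa using this.symm
  have hW2 := hΛ.sqrt_mul_eval hpW h1 h0
  rw [← hσ0, ← hσ1, hp0] at hW2
  rw [hNz] at hN1
  -- N(1) = 0 gives p(1) = -2bσ₁, whereas orthogonality of p gives p(1) = 2bσ₁.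
  have hb0 : b = 0 := by
    have : p.eval 1 = -2 * (b * σ1) := by linarith
    rw [this] at hW2
    have : b * (σ0 * σ1) = 0 := by linarith
    exact (mul_eq_zero.1 this).resolve_right (mul_pos hs0 hs1).ne'
  have hpz : p = 0 := by
    by_contra hne
    exact hΛ.eval_ne_zero hpW hne (t := -1) (by norm_num) (by rw [hp0, hb0]; ring)
  refine ⟨fun i => ?_, hb0⟩
  have hrec : ∀ i, g i = -g (i + 1) := by
    intro i
    have := coeff_genPoly_succ hgn (2 * b * σ0) i
    rw [← hp, hpz, Polynomial.coeff_zero] at this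
    linarith
  have : ∀ d i, n ≤ i + d → g i = 0 := by
    intro d
    induction d with
    | zero => exact fun i hi => hgn i hi
    | succ d ih => exact fun i hi => by rw [hrec, ih _ (by omega), neg_zero]
  exact this n i (by omega)

end IsReciprocalMoment

/-! ### The Laurent polynomial of h and the coefficients c -/

open LaguerreType (A h c A_pos A_succ h_pos)

namespace LaguerreSymbol

/-- The Laurent polynomial `(1 + z)² / (4z)`. -/
def xLaurent : ℝ[T;T⁻¹] := C (1 / 4) * (1 + T 1) ^ 2 * T (-1)

theorem xLaurent_eq : xLaurent = C (1 / 4) * (T 1 + 1 + 1 + T (-1)) := by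
  have hT : (T 1 * T (-1) : ℝ[T;T⁻¹]) = 1 := by rw [← T_add]; simp
  rw [xLaurent]
  linear_combination C (1 / 4) * (1 + 1 + T 1) * hT

theorem invert_xLaurent : invert xLaurent = xLaurent := by
  rw [xLaurent_eq, map_mul, invert_C, map_add, map_add, map_add, map_one, invert_T, invert_T,
    neg_neg]
  ring

theorem xLaurent_pow_eq (k : ℕ) : xLaurent ^ k
    = ((1 / 4 : ℝ) ^ k) • (((1 + Polynomial.X : Polynomial ℝ) ^ (2 * k)).toLaurent * T (-(k : ℤ))) := by
  rw [xLaurent, mul_pow, mul_pow, ← pow_mul, T_pow, map_pow, map_add, map_one,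
    Polynomial.toLaurent_X, smul_eq_C_mul, map_pow, mul_neg, mul_one, mul_assoc]

theorem coeff_xLaurent_pow (k : ℕ) (l : ℤ) : (xLaurent ^ k).coeff l
    = (1 / 4) ^ k * if 0 ≤ l + k then ((2 * k).choose (l + k).toNat : ℝ) else 0 := by
  rw [xLaurent_pow_eq, AddMonoidAlgebra.coeff_smul, Finsupp.smul_apply, smul_eq_mul,
    IsReciprocalMoment.coeff_mul_T, sub_neg_eq_add]
  congr 1
  split_ifs with h
  · obtain ⟨j, hj⟩ := Int.eq_ofNat_of_zero_le h
    rw [hj, coeff_toLaurent_natCast, Polynomial.coeff_one_add_X_pow]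
    simp
  · exact coeff_toLaurent_neg _ (by omega)

theorem coeff_xLaurent_pow_eq_zero (k : ℕ) {l : ℤ} (hl : (k : ℤ) < |l|) :
    (xLaurent ^ k).coeff l = 0 := by
  rw [coeff_xLaurent_pow]
  split_ifs with h
  · rw [Nat.choose_eq_zero_of_lt, Nat.cast_zero, mul_zero]
    rw [lt_abs] at hl
    omega
  · rw [mul_zero]

theorem A_eq_centralBinom (k : ℕ) : A k = (1 / 4) ^ k * (k.centralBinom : ℝ) := by
  induction k with
  | zero => simp [A]
  | succ k ih =>
    have h := Nat.succ_mul_centralBinom_succ k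
    have h' : ((k : ℝ) + 1) * ((k + 1).centralBinom : ℝ) = 2 * (2 * k + 1) * (k.centralBinom : ℝ) := by
      exact_mod_cast h
    rw [A_succ, ih, pow_succ]
    field_simp
    linear_combination -2 * h'

theorem coeff_zero_xLaurent_pow (k : ℕ) : (xLaurent ^ k).coeff 0 = A k := by
  rw [coeff_xLaurent_pow, A_eq_centralBinom, if_pos (by omega)]
  simp [Nat.centralBinom]

theorem coeff_neg_one_xLaurent_pow (k : ℕ) :
    (xLaurent ^ k).coeff (-1) = A k * (k / (k + 1)) := by
  rcases k with _ | k
  · rw [coeff_xLaurent_pow]; simp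
  · rw [coeff_xLaurent_pow, A_eq_centralBinom, if_pos (by omega)]
    have e : (-1 + ((k + 1 : ℕ) : ℤ)).toNat = k := by omega
    have h := Nat.choose_succ_right_eq (2 * (k + 1)) k
    rw [show 2 * (k + 1) - k = k + 2 by omega] at h
    have h' : ((k + 1).centralBinom : ℝ) * ((k : ℝ) + 1)
        = ((2 * (k + 1)).choose k : ℝ) * ((k : ℝ) + 2) := by
      rw [Nat.centralBinom]; exact_mod_cast h
    rw [e]
    push_cast
    have h2 : (k : ℝ) + 1 + 1 ≠ 0 := by positivity
    field_simp
    linear_combination -h'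

/-- The convolution of the central binomial and Catalan numbers. -/
theorem sum_A_mul_A_div (n : ℕ) :
    ∑ k ∈ Finset.range (n + 1), A (n - k) * (A k / (k + 1)) = 2 * A (n + 1) := by
  have hcat : ∀ k : ℕ, A k / (k + 1) = (1 / 4) ^ k * (catalan k : ℝ) := by
    intro k
    have h : ((k : ℝ) + 1) * (catalan k : ℝ) = (k.centralBinom : ℝ) := by
      exact_mod_cast succ_mul_catalan_eq_centralBinom k
    rw [A_eq_centralBinom, ← h]
    field_simp
  have hA : ∀ k : ℕ, A k = (1 / 4) ^ k * (((k : ℝ) + 1) * catalan k) := by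
    intro k
    have := hcat k
    rw [div_eq_iff (by positivity)] at this
    rw [this]; ring
  set S := ∑ k ∈ Finset.range (n + 1), A (n - k) * (A k / (k + 1)) with hS
  have h1 : S = (1 / 4) ^ n * ∑ k ∈ Finset.range (n + 1),
      ((n : ℝ) - k + 1) * (catalan k * catalan (n - k)) := by
    rw [hS, Finset.mul_sum]
    refine Finset.sum_congr rfl fun k hk => ?_
    have hk : k ≤ n := by simpa [Nat.lt_succ_iff] using hk
    rw [hcat, hA, Nat.cast_sub hk]
    have : (1 / 4 : ℝ) ^ n = (1 / 4) ^ (n - k) * (1 / 4) ^ k := by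
      rw [← pow_add, Nat.sub_add_cancel hk]
    rw [this]; ring
  -- Reflection exchanges the weights n-k+1 and k+1, whose sum n+2 is constant; the Catalan
  -- recursion then evaluates the sum.
  have h2 : ∑ k ∈ Finset.range (n + 1), ((n : ℝ) - k + 1) * (catalan k * catalan (n - k))
      = ∑ k ∈ Finset.range (n + 1), ((k : ℝ) + 1) * (catalan k * catalan (n - k)) := by
    rw [← Finset.sum_range_reflect]
    refine Finset.sum_congr rfl fun k hk => ?_
    have hk : k ≤ n := by simpa [Nat.lt_succ_iff] using hk
    rw [show n + 1 - 1 - k = n - k by omega, show n - (n - k) = k by omega, Nat.cast_sub hk]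
    ring
  have h3 : ∑ k ∈ Finset.range (n + 1), ((catalan k : ℝ) * catalan (n - k)) = catalan (n + 1) := by
    rw [catalan_succ, Finset.sum_range]
    push_cast
    rfl
  have h4 : 2 * ∑ k ∈ Finset.range (n + 1), ((n : ℝ) - k + 1) * (catalan k * catalan (n - k))
      = ((n : ℝ) + 2) * catalan (n + 1) := by
    rw [two_mul]
    nth_rewrite 2 [h2]
    rw [← Finset.sum_add_distrib, ← h3, Finset.mul_sum]
    refine Finset.sum_congr rfl fun k _ => by ring
  rw [h1, hA (n + 1), pow_succ]
  push_cast
  linear_combination (1 / 4) ^ n / 2 * h4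

/-- The Laurent polynomial `∑ A_{m-1-k} x^k`. -/
def gLaurent (m : ℕ) : ℝ[T;T⁻¹] := ∑ k ∈ Finset.range m, C (A (m - 1 - k)) * xLaurent ^ k

theorem gLaurent_succ (m : ℕ) : gLaurent (m + 1) = xLaurent * gLaurent m + C (A m) := by
  rw [gLaurent, Finset.sum_range_succ', gLaurent, Finset.mul_sum]
  congr 1
  · refine Finset.sum_congr rfl fun k _ => ?_
    rw [show m + 1 - 1 - (k + 1) = m - 1 - k by omega, pow_succ]; ring
  · simp

theorem coeff_C_mul (a : ℝ) (P : ℝ[T;T⁻¹]) (l : ℤ) : (C a * P).coeff l = a * P.coeff l := by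
  rw [← smul_eq_C_mul]; simp

theorem coeff_T_one_mul (P : ℝ[T;T⁻¹]) (l : ℤ) : (T 1 * P).coeff l = P.coeff (l - 1) := by
  rw [mul_comm, IsReciprocalMoment.coeff_mul_T]

theorem coeff_xLaurent_mul (P : ℝ[T;T⁻¹]) (l : ℤ) : (xLaurent * P).coeff l
    = 1 / 4 * (P.coeff (l - 1) + 2 * P.coeff l + P.coeff (l + 1)) := by
  rw [xLaurent_eq, mul_assoc, coeff_C_mul, add_mul, add_mul, add_mul, one_mul,
    mul_comm (T 1), mul_comm (T (-1))]
  simp only [AddMonoidAlgebra.coeff_add, Finsupp.add_apply, IsReciprocalMoment.coeff_mul_T]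
  rw [sub_neg_eq_add]; ring

/-- The nonpositive coefficients of `(1 + z) x^m` and of `(1 - z) ∑ A_{m-k} x^k` agree. -/
theorem coeff_eq_zero_of_nonpos (m : ℕ) {l : ℤ} (hl : l ≤ 0) :
    ((1 + T 1) * xLaurent ^ m - (1 - T 1) * gLaurent (m + 1)).coeff l = 0 := by
  -- The reason: 1 - 1/x = ((1-z)/(1+z))², so near z = 0 the series ∑ A_k x^{-k} equals (1+z)/(1-z).
  -- Truncating x^m times this series to nonnegative powers of x leaves O(1/x) = O(z). The induction
  -- is algebraic; at l = 0 it would need the coefficient at 1, so that case is computed directly.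
  induction m generalizing l with
  | zero =>
    have : (1 + T 1) * xLaurent ^ 0 - (1 - T 1) * gLaurent (0 + 1) = T 1 + T 1 := by
      rw [gLaurent_succ]; simp [gLaurent, A]
    rw [this]
    simp only [AddMonoidAlgebra.coeff_add, Finsupp.add_apply, T_apply]
    rw [if_neg (by omega), add_zero]
  | succ m ih =>
    rcases hl.lt_or_eq with hl | rfl
    · have e : (1 + T 1) * xLaurent ^ (m + 1) - (1 - T 1) * gLaurent (m + 1 + 1)
          = xLaurent * ((1 + T 1) * xLaurent ^ m - (1 - T 1) * gLaurent (m + 1))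
            - C (A (m + 1)) * (1 - T 1) := by
        rw [gLaurent_succ (m + 1), pow_succ]; ring
      rw [e, AddMonoidAlgebra.coeff_sub, Finsupp.sub_apply, coeff_xLaurent_mul,
        ih (by omega), ih (by omega), ih (by omega), coeff_C_mul, ← T_zero]
      simp only [AddMonoidAlgebra.coeff_sub, Finsupp.sub_apply, T_apply]
      rw [if_neg (by omega), if_neg (by omega)]
      ring
    · set N := m + 1
      rw [AddMonoidAlgebra.coeff_sub, Finsupp.sub_apply, add_mul, sub_mul, one_mul, one_mul,
        AddMonoidAlgebra.coeff_add, Finsupp.add_apply, AddMonoidAlgebra.coeff_sub,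
        Finsupp.sub_apply, coeff_T_one_mul, coeff_T_one_mul, zero_sub, coeff_zero_xLaurent_pow,
        coeff_neg_one_xLaurent_pow]
      have hg : (gLaurent (N + 1)).coeff 0 - (gLaurent (N + 1)).coeff (-1)
          = ∑ k ∈ Finset.range (N + 1), A (N - k) * (A k / (k + 1)) := by
        rw [gLaurent, AddMonoidAlgebra.coeff_sum, Finset.sum_apply', Finset.sum_apply',
          ← Finset.sum_sub_distrib]
        refine Finset.sum_congr rfl fun k _ => ?_
        rw [coeff_C_mul, coeff_C_mul, coeff_zero_xLaurent_pow, coeff_neg_one_xLaurent_pow,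
          Nat.add_sub_cancel]
        have : (k : ℝ) + 1 ≠ 0 := by positivity
        field_simp; ring
      rw [hg, sum_A_mul_A_div, A_succ N]
      have : (N : ℝ) + 1 ≠ 0 := by positivity
      field_simp; ring

/-- The function `h`, as a Laurent polynomial in `z = exp (iθ)`, where `x = cos² (θ / 2)`. -/
def hLaurent (m : ℕ) : ℝ[T;T⁻¹] := C (2 / A m) * gLaurent m

theorem invert_hLaurent (m : ℕ) : invert (hLaurent m) = hLaurent m := by
  simp only [hLaurent, gLaurent, map_mul, map_sum, map_pow, invert_C, invert_xLaurent]

theorem coeff_hLaurent_eq_zero (m : ℕ) {l : ℤ} (hl : ((m - 1 : ℕ) : ℤ) < |l|) :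
    (hLaurent m).coeff l = 0 := by
  rw [hLaurent, coeff_C_mul, gLaurent, AddMonoidAlgebra.coeff_sum, Finset.sum_apply',
    Finset.sum_eq_zero, mul_zero]
  intro k hk
  rw [Finset.mem_range] at hk
  rw [coeff_C_mul, coeff_xLaurent_pow_eq_zero k (by omega), mul_zero]

theorem c_eq_coeff {m : ℕ} (hm : 1 ≤ m) (l : ℕ) :
    c m l = 1 / A m * (xLaurent ^ (m - 1)).coeff (-l) := by
  obtain ⟨n, rfl⟩ : ∃ n, m = n + 1 := ⟨m - 1, by omega⟩
  rw [c, Nat.add_sub_cancel, coeff_xLaurent_pow]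
  have e1 : (2 : ℝ) ^ (2 - 2 * ((n + 1 : ℕ) : ℤ)) = (1 / 4) ^ n := by
    rw [show (2 : ℤ) - 2 * ((n + 1 : ℕ) : ℤ) = -((2 * n : ℕ) : ℤ) by push_cast; ring, zpow_neg,
      zpow_natCast, pow_mul, one_div, inv_pow]
    norm_num
  rw [e1, show 2 * (n + 1) - 2 = 2 * n by omega]
  by_cases h : l ≤ n
  · rw [if_pos h, if_pos (by omega), show (-(l : ℤ) + n).toNat = n - l by omega]
    ring
  · rw [if_neg h, if_neg (by omega)]
    ring

/-- `c` lists the coefficients of x^{m-1}/A_m; the identity is `coeff_eq_zero_of_nonpos` at the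
power -k. -/
theorem two_mul_c_add_c {m : ℕ} (hm : 1 ≤ m) (k : ℕ) :
    2 * (c m k + c m (k + 1)) = (hLaurent m).coeff k - (hLaurent m).coeff (k + 1) := by
  have hn : ∀ l : ℤ, (hLaurent m).coeff l = (hLaurent m).coeff (-l) := fun l => by
    rw [← invert_apply, invert_hLaurent]
  rw [c_eq_coeff hm, c_eq_coeff hm, hn, hn ((k : ℤ) + 1), hLaurent, coeff_C_mul, coeff_C_mul]
  obtain ⟨n, rfl⟩ : ∃ n, m = n + 1 := ⟨m - 1, by omega⟩
  have h := coeff_eq_zero_of_nonpos n (l := -(k : ℤ)) (by omega)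
  rw [AddMonoidAlgebra.coeff_sub, Finsupp.sub_apply, add_mul, sub_mul, one_mul, one_mul,
    AddMonoidAlgebra.coeff_add, Finsupp.add_apply, AddMonoidAlgebra.coeff_sub,
    Finsupp.sub_apply, coeff_T_one_mul, coeff_T_one_mul] at h
  rw [Nat.add_sub_cancel]
  push_cast
  rw [show -((k : ℤ) + 1) = -(k : ℤ) - 1 by ring]
  linear_combination 2 / A (n + 1) * h

/-- A general homomorphism φ covers both the evaluations at ±1 and those on the circle. -/
theorem h_eq_sum_gLaurent (m : ℕ) {S : Type*} [CommRing S] [Algebra ℝ S] (φ : ℝ[T;T⁻¹] →+* S)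
    (hφ : ∀ a, φ (C a) = algebraMap ℝ S a) {x : ℝ} (hx : φ xLaurent = algebraMap ℝ S x) :
    φ (hLaurent m) = algebraMap ℝ S (h m x) := by
  rw [hLaurent, gLaurent, map_mul, map_sum, hφ, h, map_sum, Finset.mul_sum]
  refine Finset.sum_congr rfl fun k _ => ?_
  rw [map_mul, map_pow, hφ, hx, ← map_pow, ← map_mul, ← map_mul]
  congr 1; ring

theorem sum_A (m : ℕ) : ∑ k ∈ Finset.range m, A k = 2 * m * A m := by
  induction m with
  | zero => simp
  | succ m ih =>
    rw [Finset.sum_range_succ, ih, A_succ]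
    push_cast
    field_simp

theorem h_one (m : ℕ) : h m 1 = 4 * m := by
  have hA := A_pos m
  have : h m 1 = 2 / A m * ∑ k ∈ Finset.range m, A k := by
    rw [h, ← Finset.sum_range_reflect A, Finset.mul_sum]
    refine Finset.sum_congr rfl fun k _ => ?_
    rw [one_pow]; ring
  rw [this, sum_A]
  field_simp; ring

theorem h_zero {m : ℕ} (hm : 1 ≤ m) : h m 0 = 4 * m / (2 * m - 1) := by
  obtain ⟨n, rfl⟩ : ∃ n, m = n + 1 := ⟨m - 1, by omega⟩
  have hA := A_pos n
  rw [h, Finset.sum_range_succ', Finset.sum_eq_zero, A_succ]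
  · simp only [Nat.add_sub_cancel, Nat.sub_zero, pow_zero]
    push_cast
    have h1 : (2 * (n : ℝ) + 1) ≠ 0 := by positivity
    have h2 : (2 * ((n : ℝ) + 1) - 1) = 2 * n + 1 := by ring
    rw [h2]
    field_simp; ring
  · intro k _; simp

theorem laurentEval_one_hLaurent (m : ℕ) : laurentEval 1 (hLaurent m) = 4 * m := by
  rw [← h_one]
  refine h_eq_sum_gLaurent m (laurentEval 1) (fun a => laurentEval_C _ a) ?_
  rw [xLaurent_eq]
  simp only [map_mul, map_add, map_one, laurentEval_C, laurentEval_T, one_zpow, Units.val_one]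
  simp; norm_num

theorem laurentEval_neg_one_hLaurent {m : ℕ} (hm : 1 ≤ m) :
    laurentEval (-1) (hLaurent m) = 4 * m / (2 * m - 1) := by
  rw [← h_zero hm]
  refine h_eq_sum_gLaurent m (laurentEval (-1)) (fun a => laurentEval_C _ a) ?_
  rw [xLaurent_eq]
  simp only [map_mul, map_add, map_one, laurentEval_C, laurentEval_T, zpow_one, zpow_neg]
  simp

/-! ### Integration against 1/h on the circle -/

/-- Evaluation of a real Laurent polynomial at `exp (iθ)`. -/
def circleEval (θ : ℝ) : ℝ[T;T⁻¹] →+* ℂ :=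
  eval₂ (algebraMap ℝ ℂ) (Units.mk0 (Complex.exp (θ * Complex.I)) (Complex.exp_ne_zero _))

theorem circleEval_C (θ a : ℝ) : circleEval θ (C a) = (a : ℂ) := eval₂_C _ _ _

theorem circleEval_T (θ : ℝ) (n : ℤ) :
    circleEval θ (T n) = Complex.exp (((n * θ : ℝ) : ℂ) * Complex.I) := by
  rw [circleEval, eval₂_T, Units.val_zpow_eq_zpow_val, Units.val_mk0, ← Complex.exp_int_mul]
  push_cast
  congr 1; ring

theorem circleEval_T_re (θ : ℝ) (n : ℤ) : (circleEval θ (T n)).re = Real.cos (n * θ) := by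
  rw [circleEval_T, Complex.exp_ofReal_mul_I_re]

theorem circleEval_invert (θ : ℝ) (P : ℝ[T;T⁻¹]) :
    circleEval θ (invert P) = (starRingEnd ℂ) (circleEval θ P) := by
  induction P using LaurentPolynomial.induction_on' with
  | add p q hp hq => simp only [map_add, hp, hq]
  | C_mul_T k a =>
    simp only [map_mul, invert_C, invert_T, circleEval_C, circleEval_T, Complex.conj_ofReal,
      ← Complex.exp_conj, Complex.conj_I]
    congr 2
    push_cast; ring

/-- Invariance under inversion makes the value real, so the real part suffices. -/
theorem circleEval_xLaurent (θ : ℝ) : circleEval θ xLaurent = (((1 + Real.cos θ) / 2 : ℝ) : ℂ) := by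
  have e : circleEval θ xLaurent = (starRingEnd ℂ) (circleEval θ xLaurent) := by
    rw [← circleEval_invert, invert_xLaurent]
  rw [← Complex.conj_eq_iff_re.1 e.symm, xLaurent_eq, map_mul, map_add, map_add, map_add, map_one,
    circleEval_C, Complex.re_ofReal_mul]
  simp only [Complex.add_re, circleEval_T_re, Complex.one_re, Int.cast_one, Int.cast_neg, one_mul,
    neg_mul, Real.cos_neg]
  congr 1; ring

theorem continuous_circleEval_re (P : ℝ[T;T⁻¹]) : Continuous fun θ => (circleEval θ P).re := by
  induction P using LaurentPolynomial.induction_on' with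
  | add p q hp hq =>
    simp only [map_add, Complex.add_re]
    exact hp.add hq
  | C_mul_T k a =>
    simp only [map_mul, circleEval_C, Complex.re_ofReal_mul, circleEval_T_re]
    fun_prop

/-- The real part of a Laurent polynomial on the unit circle, as a function of `x = cos² (θ / 2)`. -/
def trig (P : ℝ[T;T⁻¹]) (x : ℝ) : ℝ := (circleEval (Real.arccos (2 * x - 1)) P).re

theorem trig_add (P Q : ℝ[T;T⁻¹]) (x : ℝ) : trig (P + Q) x = trig P x + trig Q x := by
  simp [trig]

theorem trig_smul (a : ℝ) (P : ℝ[T;T⁻¹]) (x : ℝ) : trig (a • P) x = a * trig P x := by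
  rw [trig, smul_eq_C_mul, map_mul, circleEval_C, Complex.re_ofReal_mul, trig]

theorem trig_T (n : ℤ) (x : ℝ) : trig (T n) x = Real.cos (n * Real.arccos (2 * x - 1)) :=
  circleEval_T_re _ _

theorem trig_invert (P : ℝ[T;T⁻¹]) (x : ℝ) : trig (invert P) x = trig P x := by
  rw [trig, circleEval_invert, Complex.conj_re, trig]

theorem trig_mul_invert_nonneg (P : ℝ[T;T⁻¹]) (x : ℝ) : 0 ≤ trig (P * invert P) x := by
  rw [trig, map_mul, circleEval_invert, Complex.mul_conj, Complex.ofReal_re]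
  exact Complex.normSq_nonneg _

theorem trig_hLaurent_mul (m : ℕ) (P : ℝ[T;T⁻¹]) {x : ℝ} (hx : x ∈ Set.Icc (0 : ℝ) 1) :
    trig (hLaurent m * P) x = h m x * trig P x := by
  have e : circleEval (Real.arccos (2 * x - 1)) (hLaurent m) = ((h m x : ℝ) : ℂ) := by
    refine h_eq_sum_gLaurent m (circleEval _) (fun a => circleEval_C _ a) ?_
    rw [circleEval_xLaurent, Real.cos_arccos (by linarith [hx.1]) (by linarith [hx.2])]
    rw [Complex.coe_algebraMap]
    congr 1; ring
  rw [trig, map_mul, e, Complex.re_ofReal_mul, trig]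

theorem continuous_trig (P : ℝ[T;T⁻¹]) : Continuous (trig P) :=
  (continuous_circleEval_re P).comp (by fun_prop)

theorem intervalIntegrable_div_sqrt {g : ℝ → ℝ} (hg : ContinuousOn g (Set.Icc 0 1)) :
    IntervalIntegrable (fun x => g x / (√x * √(1 - x))) MeasureTheory.volume 0 1 := by
  rw [intervalIntegrable_iff_integrableOn_Ioo_of_le zero_le_one]
  obtain ⟨B, hB⟩ := isCompact_Icc.exists_bound_of_continuousOn hg
  have hm : MeasureTheory.AEStronglyMeasurable (fun x => g x / (√x * √(1 - x)))
      (MeasureTheory.volume.restrict (Set.Ioo (0 : ℝ) 1)) := by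
    have h1 : MeasureTheory.AEStronglyMeasurable g
        (MeasureTheory.volume.restrict (Set.Ioo (0 : ℝ) 1)) :=
      (hg.mono Set.Ioo_subset_Icc_self).aestronglyMeasurable measurableSet_Ioo
    have h2 : Measurable fun x : ℝ => (√x * √(1 - x))⁻¹ := by fun_prop
    simp only [div_eq_mul_inv]
    exact h1.mul h2.aestronglyMeasurable
  refine (LaguerreType.integrable_bound (B * 2)).mono' hm ?_
  filter_upwards [MeasureTheory.ae_restrict_mem measurableSet_Ioo] with x hx
  have h1 := hB x (Set.Ioo_subset_Icc_self hx)
  have h2 := LaguerreType.inv_sqrt_mul_le hx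
  have h3 : 0 ≤ (√x * √(1 - x))⁻¹ := by positivity
  rw [div_eq_mul_inv, norm_mul, Real.norm_of_nonneg h3]
  calc _ ≤ B * (2 * (x ^ (-(1 / 2) : ℝ) + (1 - x) ^ (-(1 / 2) : ℝ))) :=
        mul_le_mul h1 h2 h3 ((norm_nonneg _).trans h1)
    _ = _ := by ring

theorem integral_cos_arccos {n : ℤ} (hn : n ≠ 0) :
    ∫ x in (0 : ℝ)..1, Real.cos (n * Real.arccos (2 * x - 1)) / (√x * √(1 - x)) = 0 := by
  have hderiv : ∀ x ∈ Set.Ioo (0 : ℝ) 1, HasDerivAt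
      (fun x => -(Real.sin (n * Real.arccos (2 * x - 1)) / n))
      (Real.cos (n * Real.arccos (2 * x - 1)) / (√x * √(1 - x))) x := by
    intro x hx
    have h1 : HasDerivAt (fun x : ℝ => 2 * x - 1) 2 x := by
      simpa using ((hasDerivAt_id x).const_mul 2).sub_const 1
    have h2 := (Real.hasDerivAt_arccos (x := 2 * x - 1) (by linarith [hx.1])
      (by linarith [hx.2])).comp x h1
    have h3 := ((h2.const_mul (n : ℝ)).sin.div_const (n : ℝ)).neg
    refine h3.congr_deriv ?_
    have e : √(1 - (2 * x - 1) ^ 2) = 2 * (√x * √(1 - x)) := by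
      rw [← Real.sqrt_mul hx.1.le, show 1 - (2 * x - 1) ^ 2 = 2 ^ 2 * (x * (1 - x)) by ring,
        Real.sqrt_mul (by norm_num), Real.sqrt_sq (by norm_num)]
    rw [e]
    have hs1 : √x ≠ 0 := (Real.sqrt_pos.2 hx.1).ne'
    have hs2 : √(1 - x) ≠ 0 := (Real.sqrt_pos.2 (by linarith [hx.2])).ne'
    have hn' : (n : ℝ) ≠ 0 := by exact_mod_cast hn
    simp only [Function.comp]
    field_simp
  rw [intervalIntegral.integral_eq_sub_of_hasDerivAt_of_le zero_le_one (by fun_prop) hderiv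
    (intervalIntegrable_div_sqrt (by fun_prop))]
  norm_num [Real.sin_int_mul_pi]

theorem integral_inv_sqrt :
    ∫ x in (0 : ℝ)..1, (1 : ℝ) / (√x * √(1 - x)) = Real.pi := by
  have hderiv : ∀ x ∈ Set.Ioo (0 : ℝ) 1, HasDerivAt
      (fun x => -Real.arccos (2 * x - 1)) (1 / (√x * √(1 - x))) x := by
    intro x hx
    have h1 : HasDerivAt (fun x : ℝ => 2 * x - 1) 2 x := by
      simpa using ((hasDerivAt_id x).const_mul 2).sub_const 1
    have h2 := (Real.hasDerivAt_arccos (x := 2 * x - 1) (by linarith [hx.1])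
      (by linarith [hx.2])).comp x h1
    refine h2.neg.congr_deriv ?_
    have e : √(1 - (2 * x - 1) ^ 2) = 2 * (√x * √(1 - x)) := by
      rw [← Real.sqrt_mul hx.1.le, show 1 - (2 * x - 1) ^ 2 = 2 ^ 2 * (x * (1 - x)) by ring,
        Real.sqrt_mul (by norm_num), Real.sqrt_sq (by norm_num)]
    rw [e]
    have hs1 : √x ≠ 0 := (Real.sqrt_pos.2 hx.1).ne'
    have hs2 : √(1 - x) ≠ 0 := (Real.sqrt_pos.2 (by linarith [hx.2])).ne'
    field_simp
  rw [intervalIntegral.integral_eq_sub_of_hasDerivAt_of_le zero_le_one (by fun_prop) hderiv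
    (intervalIntegrable_div_sqrt (by fun_prop))]
  norm_num

theorem integral_trig (P : ℝ[T;T⁻¹]) :
    ∫ x in (0 : ℝ)..1, trig P x / (√x * √(1 - x)) = Real.pi * P.coeff 0 := by
  induction P using LaurentPolynomial.induction_on' with
  | add p q hp hq =>
    simp only [trig_add, add_div]
    rw [intervalIntegral.integral_add
      (intervalIntegrable_div_sqrt (continuous_trig p).continuousOn)
      (intervalIntegrable_div_sqrt (continuous_trig q).continuousOn), hp, hq]
    simp; ring
  | C_mul_T k a =>
    rw [← smul_eq_C_mul]
    simp only [trig_smul, trig_T, mul_div_assoc]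
    rw [intervalIntegral.integral_const_mul]
    rcases eq_or_ne k 0 with rfl | hk
    · simp only [Int.cast_zero, zero_mul, Real.cos_zero, integral_inv_sqrt, T_zero]
      have : (1 : ℝ[T;T⁻¹]).coeff 0 = 1 := by rw [← T_zero]; simp
      simp [this, mul_comm]
    · rw [integral_cos_arccos hk]
      simp [hk]

theorem intervalIntegrable_trig_div {m : ℕ} (hm : 1 ≤ m) (P : ℝ[T;T⁻¹]) :
    IntervalIntegrable (fun x => trig P x / h m x / (√x * √(1 - x))) MeasureTheory.volume 0 1 :=
  intervalIntegrable_div_sqrt ((continuous_trig P).continuousOn.div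
    (LaguerreType.continuous_h m).continuousOn fun _ hx => (h_pos hm hx.1).ne')

/-- Integration on the unit circle against `1 / h`. -/
def moment {m : ℕ} (hm : 1 ≤ m) : ℝ[T;T⁻¹] →ₗ[ℝ] ℝ where
  toFun P := 1 / Real.pi * ∫ x in (0 : ℝ)..1, trig P x / h m x / (√x * √(1 - x))
  map_add' P Q := by
    simp only [trig_add, add_div]
    rw [intervalIntegral.integral_add (intervalIntegrable_trig_div hm P)
      (intervalIntegrable_trig_div hm Q), mul_add]
  map_smul' a P := by
    simp only [trig_smul, mul_div_assoc, RingHom.id_apply, smul_eq_mul]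
    rw [intervalIntegral.integral_const_mul]
    ring

theorem moment_apply {m : ℕ} (hm : 1 ≤ m) (P : ℝ[T;T⁻¹]) : moment hm P
    = 1 / Real.pi * ∫ x in (0 : ℝ)..1, trig P x / h m x / (√x * √(1 - x)) := rfl

theorem isReciprocalMoment_moment {m : ℕ} (hm : 1 ≤ m) :
    IsReciprocalMoment (hLaurent m) (moment hm) where
  invert_eq := invert_hLaurent m
  map_invert P := by simp only [moment_apply, trig_invert]
  map_left_mul P := by
    have e : ∫ x in (0 : ℝ)..1, trig (hLaurent m * P) x / h m x / (√x * √(1 - x))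
        = ∫ x in (0 : ℝ)..1, trig P x / (√x * √(1 - x)) := by
      refine intervalIntegral.integral_congr fun x hx => ?_
      rw [Set.uIcc_of_le zero_le_one] at hx
      rw [trig_hLaurent_mul m P hx, mul_div_cancel_left₀ _ (h_pos hm hx.1).ne']
    rw [moment_apply, e, integral_trig]
    have := Real.pi_ne_zero
    field_simp
  nonneg P := by
    rw [moment_apply]
    refine mul_nonneg (by positivity) (intervalIntegral.integral_nonneg zero_le_one fun x hx => ?_)
    exact div_nonneg (div_nonneg (trig_mul_invert_nonneg P x) (h_pos hm hx.1).le) (by positivity)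

theorem h_zero_le {m : ℕ} {x : ℝ} (hx : 0 ≤ x) : h m 0 ≤ h m x := by
  unfold h
  refine Finset.sum_le_sum fun k _ => ?_
  have h1 := A_pos (m - 1 - k)
  have h2 := A_pos m
  have h3 : (0 : ℝ) ^ k ≤ x ^ k := pow_le_pow_left₀ le_rfl hx k
  gcongr

theorem mul_moment_le {m : ℕ} (hm : 1 ≤ m) (P : ℝ[T;T⁻¹]) :
    h m 0 * moment hm (P * invert P) ≤ moment hm (hLaurent m * (P * invert P)) := by
  rw [← smul_eq_mul, ← map_smul, moment_apply, moment_apply]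
  refine mul_le_mul_of_nonneg_left (intervalIntegral.integral_mono_on zero_le_one
    (intervalIntegrable_trig_div hm _) (intervalIntegrable_trig_div hm _) fun x hx => ?_)
    (by positivity)
  rw [trig_hLaurent_mul m _ hx, trig_smul]
  have h1 := h_zero_le (m := m) hx.1
  have h2 := h_pos hm hx.1
  have h3 := trig_mul_invert_nonneg P x
  gcongr

/-- The moments tend to zero. -/
theorem tendsto_moment {m : ℕ} (hm : 1 ≤ m) :
    Tendsto (fun k : ℤ => moment hm (T k)) atTop (𝓝 0) := by
  have hΛ := isReciprocalMoment_moment hm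
  set Λ := moment hm with hΛdef
  have h0 : 0 < h m 0 := h_pos hm le_rfl
  -- A Bessel inequality: as H ≥ h(0) on the circle, the moments are square summable.
  have hB : ∀ M : ℕ, ∑ k ∈ Finset.range M, Λ (T (k : ℤ)) ^ 2 ≤ Λ 1 / h m 0 := by
    intro M
    set B := ∑ k ∈ Finset.range M, Λ (T (k : ℤ)) ^ 2 with hBdef
    set P : ℝ[T;T⁻¹] := ∑ k ∈ Finset.range M, Λ (T (k : ℤ)) • T (k : ℤ) with hP
    have hcoeff : ∀ k ∈ Finset.range M, P.coeff (k : ℤ) = Λ (T (k : ℤ)) := by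
      intro k hk
      rw [hP, AddMonoidAlgebra.coeff_sum, Finset.sum_apply']
      simp only [AddMonoidAlgebra.coeff_smul, Finsupp.smul_apply, T_apply, smul_eq_mul, mul_ite,
        mul_one, mul_zero, Nat.cast_inj, Finset.sum_ite_eq', if_pos hk]
    have e1 : Λ P = B := by
      rw [hP, map_sum]
      exact Finset.sum_congr rfl fun k _ => by rw [map_smul, smul_eq_mul, sq]
    have e2 : Λ (hLaurent m * (P * invert P)) = B := by
      rw [hΛ.map_left_mul]
      nth_rewrite 1 [hP]
      rw [Finset.sum_mul, AddMonoidAlgebra.coeff_sum, Finset.sum_apply']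
      refine Finset.sum_congr rfl fun k hk => ?_
      rw [smul_mul_assoc, AddMonoidAlgebra.coeff_smul, Finsupp.smul_apply, mul_comm (T _),
        IsReciprocalMoment.coeff_mul_T, invert_apply, zero_sub, neg_neg, hcoeff k hk, smul_eq_mul,
        sq]
    have e3 := mul_moment_le hm P
    rw [← hΛdef, e2] at e3
    -- Here Λ(P) = B and Λ(|P|²) ≤ B/h(0), so the constant 1/h(0) gives 0 ≤ B/h(0) - 2B/h(0) +
    -- Λ(1)/h(0)², which is the bound.
    have e4 := hΛ.nonneg (P - C (1 / h m 0))
    have e5 : (P - C (1 / h m 0)) * invert (P - C (1 / h m 0))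
        = P * invert P - (1 / h m 0) • P - (1 / h m 0) • invert P + ((1 / h m 0) ^ 2) • 1 := by
      simp only [map_sub, invert_C, smul_eq_C_mul, map_pow]; ring
    rw [e5, map_add, map_sub, map_sub, map_smul, map_smul, map_smul, hΛ.map_invert, e1] at e4
    simp only [smul_eq_mul] at e4
    have e6 : Λ (P * invert P) ≤ B / h m 0 := by
      rw [le_div_iff₀ h0]; linarith
    have e7 : 0 ≤ (Λ 1 / h m 0 - B) / h m 0 := by
      have : (Λ 1 / h m 0 - B) / h m 0
          = B / h m 0 - 1 / h m 0 * B - 1 / h m 0 * B + (1 / h m 0) ^ 2 * Λ 1 := by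
        field_simp; ring
      rw [this]; linarith
    have := mul_nonneg e7 h0.le
    rw [div_mul_cancel₀ _ h0.ne'] at this
    linarith
  have hs : Summable fun k : ℕ => Λ (T (k : ℤ)) ^ 2 :=
    summable_of_sum_range_le (fun k => sq_nonneg _) hB
  have hn : Tendsto (fun k : ℕ => Λ (T (k : ℤ))) atTop (𝓝 0) := by
    have := hs.tendsto_atTop_zero.sqrt
    simp only [Real.sqrt_sq_eq_abs, Real.sqrt_zero] at this
    exact (tendsto_zero_iff_abs_tendsto_zero _).2 this
  have h2 : Tendsto (fun k : ℤ => Λ (T (k.toNat : ℤ))) atTop (𝓝 0) :=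
    hn.comp (tendsto_atTop.2 fun b => by
      filter_upwards [eventually_ge_atTop (b : ℤ)] with k hk
      omega)
  refine h2.congr' ?_
  filter_upwards [eventually_ge_atTop (0 : ℤ)] with k hk
  rw [Int.toNat_of_nonneg hk]

/-! ### The integrals as partial sums of moments, and the matrix -/

theorem sin_half_mul_sum_cos (θ : ℝ) (q : ℕ) :
    Real.sin (θ / 2) * ∑ k ∈ Finset.range (q + 1), (if k = 0 then 1 else 2) * Real.cos (k * θ)
      = Real.sin (((q : ℝ) + 1 / 2) * θ) := by
  induction q with
  | zero => simp; congr 1; ring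
  | succ q ih =>
    rw [Finset.sum_range_succ, mul_add, ih, if_neg (by omega)]
    push_cast
    rw [show ((q : ℝ) + 1 + 1 / 2) * θ = ((q : ℝ) + 1) * θ + θ / 2 by ring,
      show ((q : ℝ) + 1 / 2) * θ = ((q : ℝ) + 1) * θ - θ / 2 by ring, Real.sin_add, Real.sin_sub]
    ring

theorem sin_half_arccos {x : ℝ} (hx : x ∈ Set.Icc (0 : ℝ) 1) :
    Real.sin (Real.arccos (2 * x - 1) / 2) = √(1 - x) := by
  rw [Real.sin_half_eq_sqrt (Real.arccos_nonneg _)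
    (by linarith [Real.arccos_le_pi (2 * x - 1), Real.pi_pos]),
    Real.cos_arccos (by linarith [hx.1]) (by linarith [hx.2])]
  congr 1; ring

theorem cos_half_arccos {x : ℝ} (hx : x ∈ Set.Icc (0 : ℝ) 1) :
    Real.cos (Real.arccos (2 * x - 1) / 2) = √x := by
  rw [Real.cos_half (by linarith [Real.arccos_nonneg (2 * x - 1), Real.pi_pos])
    (Real.arccos_le_pi _), Real.cos_arccos (by linarith [hx.1]) (by linarith [hx.2])]
  congr 1; ring

/-- By the Dirichlet kernel the sine is sin(θ/2) = √(1-x) times a cosine sum, which cancels one of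
the two factors √(1-x) of 1-x. -/
theorem I_succ_eq {m : ℕ} (hm : 1 ≤ m) (q : ℕ) :
    LaguerreType.I m (q + 1) = 2 * symmSum (moment hm) (q + 1) := by
  have e : symmSum (moment hm) (q + 1) = moment hm
      (∑ k ∈ Finset.range (q + 1), (if k = 0 then (1 : ℝ) else 2) • T (k : ℤ)) := by
    rw [symmSum, map_sum]
    exact Finset.sum_congr rfl fun k _ => by rw [map_smul, smul_eq_mul]
  have ht : ∀ x, trig (∑ k ∈ Finset.range (q + 1), (if k = 0 then (1 : ℝ) else 2) • T (k : ℤ)) x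
      = ∑ k ∈ Finset.range (q + 1), (if k = 0 then 1 else 2)
        * Real.cos (k * Real.arccos (2 * x - 1)) := by
    intro x
    rw [trig, map_sum, Complex.re_sum]
    refine Finset.sum_congr rfl fun k _ => ?_
    rw [← trig, trig_smul, trig_T, Int.cast_natCast]
  rw [e, moment_apply, LaguerreType.I]
  have hint : ∫ x in (0 : ℝ)..1,
      Real.sin ((((q + 1 : ℕ) : ℝ) - 1 / 2) * Real.arccos (2 * x - 1)) / (h m x * √x * (1 - x))
      = ∫ x in (0 : ℝ)..1, trig (∑ k ∈ Finset.range (q + 1),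
        (if k = 0 then (1 : ℝ) else 2) • T (k : ℤ)) x / h m x / (√x * √(1 - x)) := by
    refine intervalIntegral.integral_congr fun x hx => ?_
    rw [Set.uIcc_of_le zero_le_one] at hx
    rw [ht, show (((q + 1 : ℕ) : ℝ) - 1 / 2) = (q : ℝ) + 1 / 2 by push_cast; ring,
      ← sin_half_mul_sum_cos, sin_half_arccos hx]
    rcases hx.2.eq_or_lt with rfl | hx1
    · simp
    · have hs : 0 < √(1 - x) := Real.sqrt_pos.2 (by linarith)
      have hsq : 1 - x = √(1 - x) * √(1 - x) := (Real.mul_self_sqrt (by linarith)).symm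
      rw [div_div, hsq, ← mul_assoc (h m x * √x), Real.sqrt_mul_self hs.le,
        mul_comm (√(1 - x)) (Finset.sum _ _), mul_div_mul_right _ _ hs.ne', mul_assoc]
  rw [hint]
  ring

/-- Since √x = cos(θ/2), the product 2 sin(qθ)√x is a sum of two half-integer sines, so Î(q) is the
mean of I(q) and I(q+1). -/
theorem Ihat_succ_eq {m : ℕ} (hm : 1 ≤ m) (q : ℕ) :
    LaguerreType.Ihat m (q + 1)
      = symmSum (moment hm) (q + 1) + symmSum (moment hm) (q + 2) := by
  have e : LaguerreType.Ihat m (q + 1)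
      = 1 / 2 * (LaguerreType.I m (q + 1) + LaguerreType.I m (q + 2)) := by
    have hadd := intervalIntegral.integral_add
      (LaguerreType.intervalIntegrable_I hm (q := q + 1) (by omega))
      (LaguerreType.intervalIntegrable_I hm (q := q + 2) (by omega))
    rw [LaguerreType.Ihat, LaguerreType.I, LaguerreType.I, ← mul_add, ← hadd, ← mul_assoc,
      mul_comm (1 / 2 : ℝ), mul_assoc, ← intervalIntegral.integral_const_mul (1 / 2 : ℝ)]
    congr 1
    refine intervalIntegral.integral_congr fun x hx => ?_
    rw [Set.uIcc_of_le zero_le_one] at hx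
    set θ := Real.arccos (2 * x - 1) with hθ
    have hsum : Real.sin ((((q + 1 : ℕ) : ℝ) - 1 / 2) * θ) + Real.sin ((((q + 2 : ℕ) : ℝ) - 1 / 2) * θ)
        = 2 * (Real.sin (((q + 1 : ℕ) : ℝ) * θ) * √x) := by
      rw [← cos_half_arccos hx, ← hθ]
      push_cast
      rw [show ((q : ℝ) + 1 - 1 / 2) * θ = ((q : ℝ) + 1) * θ - θ / 2 by ring,
        show ((q : ℝ) + 2 - 1 / 2) * θ = ((q : ℝ) + 1) * θ + θ / 2 by ring, Real.sin_add,
        Real.sin_sub]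
      ring
    rw [← add_div, hsum]
    -- At x = 0 the integrands of `I` are 0 through division by zero; that of `Ihat` agrees because
    -- sin((q+1)π) = 0.
    rcases hx.1.eq_or_lt with rfl | hx0
    · have : θ = Real.pi := by rw [hθ]; norm_num
      rw [this, Real.sin_nat_mul_pi]; simp
    · have hs : √x ≠ 0 := (Real.sqrt_pos.2 hx0).ne'
      have hh : h m x ≠ 0 := (h_pos hm hx.1).ne'
      rcases hx.2.eq_or_lt with rfl | hx1
      · simp
      · have h1 : 1 - x ≠ 0 := by linarith
        field_simp
  rw [e, I_succ_eq hm, I_succ_eq hm]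
  ring

theorem sqrt_h_zero {m : ℕ} (hm : 1 ≤ m) : √(laurentEval (-1) (hLaurent m))
    = 2 * √((m : ℝ) / (2 * m - 1)) := by
  rw [laurentEval_neg_one_hLaurent hm,
    show (4 * (m : ℝ) / (2 * m - 1)) = 2 ^ 2 * (m / (2 * m - 1)) by ring,
    Real.sqrt_mul (by norm_num), Real.sqrt_sq (by norm_num)]

theorem sqrt_h_one (m : ℕ) : √(laurentEval 1 (hLaurent m)) = 2 * √(m : ℝ) := by
  rw [laurentEval_one_hLaurent, show (4 * (m : ℝ)) = 2 ^ 2 * m by ring,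
    Real.sqrt_mul (by norm_num), Real.sqrt_sq (by norm_num)]

theorem mulVec_eq_zero {m : ℕ} (hm : 1 ≤ m) {w : Fin (m - 1) ⊕ Unit → ℝ}
    (hw : (LaguerreType.T m).mulVec w = 0) : w = 0 := by
  have hm1 : (1 : ℝ) ≤ m := by exact_mod_cast hm
  have hw' : w = (LaguerreType.X m).mulVec ((LaguerreType.Y m).mulVec w) := by
    rw [LaguerreType.T, Matrix.sub_mulVec, Matrix.one_mulVec, sub_eq_zero] at hw
    rw [Matrix.mulVec_mulVec]
    exact hw
  set σ0 := √(laurentEval (-1) (hLaurent m)) with hσ0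
  set σ1 := √(laurentEval 1 (hLaurent m)) with hσ1
  set S := symmSum (moment hm) with hS
  set b := w (Sum.inr ()) / 2 with hb
  set w' : ℕ → ℝ := fun j => if hj : j < m - 1 then w (Sum.inl ⟨j, hj⟩) else 0 with hw'def
  have hw'val : ∀ j : Fin (m - 1), w' j = w (Sum.inl j) := fun j => by
    simp [hw'def]
  set g : ℕ → ℝ := fun i => ∑ j ∈ Finset.range (m - 1), LaguerreType.c m (i + j + 1) * w' j with hg
  -- f is extended by its formula and not by zero, since its limit at infinity is needed; it agrees
  -- with `w'` below m-1.
  set f : ℕ → ℝ := fun i => ∑ j ∈ Finset.range (m - 1), g j * (S (i + j + 1) + S (i + j + 2))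
      + b * (σ0 * S (i + 1) - 1 / σ1) with hf
  have hYl : ∀ i : Fin (m - 1), (LaguerreType.Y m).mulVec w (Sum.inl i) = g i := by
    intro i
    rw [LaguerreType.Y, Matrix.fromBlocks_mulVec, Sum.elim_inl]
    simp only [Matrix.zero_mulVec, add_zero, Matrix.mulVec, dotProduct, LaguerreType.Q,
      Matrix.of_apply, Function.comp]
    rw [hg]
    simp only
    rw [Finset.sum_range]
    exact Finset.sum_congr rfl fun j _ => by rw [hw'val]
  have hYr : (LaguerreType.Y m).mulVec w (Sum.inr ()) = b := by
    rw [LaguerreType.Y, Matrix.fromBlocks_mulVec, Sum.elim_inr]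
    simp only [Matrix.zero_mulVec, zero_add, Matrix.mulVec, dotProduct, Matrix.of_apply,
      Function.comp, Finset.univ_unique, Finset.sum_singleton]
    rw [hb]
    simp only [PUnit.default_eq_unit]
    ring
  have hv : ∀ j : ℕ, √((m : ℝ) / (2 * m - 1)) * LaguerreType.I m (j + 1) - 1 / (2 * √(m : ℝ))
      = σ0 * S (j + 1) - 1 / σ1 := by
    intro j
    rw [hσ0, hσ1, sqrt_h_zero hm, sqrt_h_one, I_succ_eq hm, hS]
    ring
  have hY : (LaguerreType.Y m).mulVec w = Sum.elim (fun i : Fin (m - 1) => g i) (fun _ => b) := by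
    funext s
    rcases s with i | u
    · exact hYl i
    · exact hYr
  have hX : (LaguerreType.X m).mulVec ((LaguerreType.Y m).mulVec w)
      = Sum.elim (fun i : Fin (m - 1) => f i) (fun _ => ∑ j ∈ Finset.range (m - 1),
        g j * (σ0 * S (j + 1) - 1 / σ1) + (1 - 1 / √(2 * (m : ℝ) - 1)) * b) := by
    rw [hY, LaguerreType.X, Matrix.fromBlocks_mulVec]
    congr 1
    · funext i
      simp only [Pi.add_apply, Matrix.mulVec, dotProduct, LaguerreType.R, LaguerreType.v,
        Matrix.transpose_apply, Matrix.of_apply, Function.comp, Finset.univ_unique,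
        Finset.sum_singleton, Sum.elim_inl, Sum.elim_inr, hv]
      rw [hf]
      simp only
      rw [Finset.sum_range]
      congr 1
      · refine Finset.sum_congr rfl fun j _ => ?_
        rw [Ihat_succ_eq hm, hS]; ring
      · ring
    · funext i
      simp only [Pi.add_apply, Matrix.mulVec, dotProduct, LaguerreType.v,
        Matrix.of_apply, Function.comp, Finset.univ_unique,
        Finset.sum_singleton, Sum.elim_inl, Sum.elim_inr, hv]
      rw [Finset.sum_range]
      congr 1
      exact Finset.sum_congr rfl fun j _ => by ring
  rw [hX] at hw'
  have hfw : ∀ i < m - 1, f i = w' i := by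
    intro i hi
    have := congrFun hw' (Sum.inl ⟨i, hi⟩)
    rw [Sum.elim_inl] at this
    rw [← this, ← hw'val]
  have hbeq : (1 + σ0 / σ1) * b = ∑ j ∈ Finset.range (m - 1), g j * (σ0 * S (j + 1) - 1 / σ1) := by
    have h1 := congrFun hw' (Sum.inr ())
    rw [Sum.elim_inr] at h1
    have e : σ0 / σ1 = 1 / √(2 * (m : ℝ) - 1) := by
      have hs : √(m : ℝ) ≠ 0 := (Real.sqrt_pos.2 (by linarith)).ne'
      rw [hσ0, hσ1, sqrt_h_zero hm, sqrt_h_one, Real.sqrt_div (by linarith)]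
      field_simp
    rw [e]
    have hb2 : w (Sum.inr ()) = 2 * b := by rw [hb]; ring
    rw [hb2] at h1
    linarith
  obtain ⟨hg0, hb0⟩ := (isReciprocalMoment_moment hm).eq_zero_of_mem_kernel
    (n := m - 1) (fun l hl => coeff_hLaurent_eq_zero m hl) (tendsto_moment hm)
    (by rw [laurentEval_one_hLaurent]; linarith)
    (by rw [laurentEval_neg_one_hLaurent hm]; exact div_pos (by linarith) (by linarith))
    (c := LaguerreType.c m) (two_mul_c_add_c hm)
    (fun k hk => by rw [LaguerreType.c, if_neg (by omega), mul_zero])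
    (f := f) (g := g) (b := b) (fun i => rfl)
    (fun i => Finset.sum_congr rfl fun j hj => by rw [hfw j (Finset.mem_range.1 hj)]) hbeq
  funext s
  rcases s with i | u
  · rw [hw', Sum.elim_inl, hf]
    simp [hg0, hb0]
  · have hb2 : w (Sum.inr ()) = 2 * b := by rw [hb]; ring
    rw [hb0] at hb2
    simpa using hb2

end LaguerreSymbol

end

theorem theorem2p7 (m : ℕ) (hm : 1 ≤ m) : IsUnit (LaguerreType.T m) := by
  rw [← Matrix.mulVec_injective_iff_isUnit]
  intro v w hvw
  have h : (LaguerreType.T m).mulVec (v - w) = 0 := by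
    rw [Matrix.mulVec_sub, sub_eq_zero]
    exact hvw
  exact sub_eq_zero.1 (LaguerreSymbol.mulVec_eq_zero hm h)
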